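/- Let $M$ be a smooth (finite-dimensional, Hausdorff, real) manifold and let $(E,q,[\![\,,\,]\!])$ be a Lie algebroid over $M$: $E\to M$ is a smooth real vector bundle of finite rank, $q:E\to TM$ is a vector bundle map over $M$, and $[\![\,,\,]\!]$ is a Lie bracket on $\Gamma E$ with $[\![A,fB]\!]=f[\![A,B]\!]+qA(f)\,B$ for $A,B\in\Gamma E$, $f\in C^\infty(M)$. Let $\nabla$ be a linear connection on $E$. (a) There is exactly one derivation $D$ of degree $1$ of $\Gamma(\Lambda^\bullet E^*)$, that is, one family of $\mathbb{R}$-linear maps $D:\Gamma(\Lambda^pE^*)\to\Gamma(\Lambda^{p+1}E^*)$ with $D(\alpha\wedge\beta)=D\alpha\wedge\beta+(-1)^{p}\alpha\wedge D\beta$ for $\alpha\in\Gamma(\Lambda^pE^*)$, such that $$Df(A)=qA(f),\qquad D\alpha(A,B)=qA(\alpha(B))-qB(\alpha(A))-\alpha([\![A,B]\!])$$ for all $f\in C^\infty(M)$, $\alpha\in\Gamma(E^*)$, $A,B\in\Gamma E$ (the differential of the Lie algebroid). (b) There is a tensor field $L^\nabla\in\Gamma(\Lambda^2E^*\otimes E)$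 with $$L^\nabla(A,B)=\nabla_{qA}B-\nabla_{qB}A-[\![A,B]\!]\qquad(A,B\in\Gamma E),$$ the torsion $\delta_AB-\delta_BA-[\![A,B]\!]$ of the $E$-connection $\delta_AB=\nabla_{qA}B$ on $E$, and $$D=\nabla_q+\imath_{L^\nabla}\quad\text{on }\Gamma(\Lambda^pE^*)\text{ for all }p\ge 0 .$$ Here $\nabla_q$ is the operator $$(\nabla_q\omega)(A_0,\dots,A_p)=\sum_{i=0}^p(-1)^i(\nabla_{qA_i}\omega)(A_0,\dots,\widehat{A_i},\dots,A_p),$$ $$(\nabla_X\omega)(B_1,\dots,B_p)=X(\omega(B_1,\dots,B_p))-\sum_{j}\omega(B_1,\dots,\nabla_XB_j,\dots,B_p),$$ and $\imath_L$ is the insertion $$(\imath_L\omega)(A_0,\dots,A_p)=\sum_{i<j}(-1)^{i+j+1}\omega(L(A_i,A_j),A_0,\dots,\widehat{A_i},\dots,\widehat{A_j},\dots,A_p),$$ which is zero on functions. -/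

import Mathlib

open Bundle Function
open scoped Manifold ContDiff Topology

noncomputable section

namespace LieAlgd

variable {E : Type*} [NormedAddCommGroup E] [NormedSpace ℝ E]
  {H : Type*} [TopologicalSpace H] (I : ModelWithCorners ℝ E H)
  {M : Type*} [TopologicalSpace M] [ChartedSpace H M]
  (F : Type*) [NormedAddCommGroup F] [NormedSpace ℝ F]
  (V : M → Type*) [TopologicalSpace (TotalSpace F V)]
  [∀ x, AddCommGroup (V x)] [∀ x, Module ℝ (V x)] [∀ x, TopologicalSpace (V x)]
  [FiberBundle F V]

/-! ### Exterior forms on a vector bundle -/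

/-- `Γ(Λᵖ V*)`: families of alternating `p`-linear forms on the fibres of `V` which are smooth, that
is, which give a smooth function when evaluated on smooth sections of `V`. -/
def EForm (p : ℕ) : Submodule ℝ (∀ x : M, V x [⋀^Fin p]→ₗ[ℝ] ℝ) where
  carrier := {η | ∀ A : Fin p → Cₛ^∞⟮I; F, V⟯,
    ContMDiff I 𝓘(ℝ, ℝ) ∞ fun x => η x fun i => A i x}
  add_mem' h h' A := (h A).add (h' A)
  zero_mem' _ := contMDiff_const
  smul_mem' _ _ h A := contMDiff_const.mul (h A)

/-- `Γ(Λᵏ V* ⊗ V)`: families of alternating `k`-linear maps `(V x)ᵏ → V x` which are smooth, that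
is, which give a smooth section of `V` when evaluated on smooth sections of `V`. -/
structure EValuedForm (k : ℕ) where
  toFun : ∀ x : M, V x [⋀^Fin k]→ₗ[ℝ] V x
  smooth : ∀ A : Fin k → Cₛ^∞⟮I; F, V⟯,
    ContMDiff I (I.prod 𝓘(ℝ, F)) ∞ fun x => (⟨x, toFun x fun i => A i x⟩ : TotalSpace F V)

variable {I F V}

/-- The value `η(A₁, …, Aₚ)` as a smooth function. -/
def evalForm {p : ℕ} (η : EForm I F V p) (A : Fin p → Cₛ^∞⟮I; F, V⟯) : C^∞⟮I, M; ℝ⟯ :=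
  ⟨fun x => η.1 x fun i => A i x, η.2 A⟩

/-- The value `L(A₁, …, Aₖ)` as a smooth section. -/
def EValuedForm.eval {k : ℕ} (L : EValuedForm I F V k) (A : Fin k → Cₛ^∞⟮I; F, V⟯) :
    Cₛ^∞⟮I; F, V⟯ :=
  ⟨fun x => L.toFun x fun i => A i x, L.smooth A⟩

/-- A smooth function as a form of degree `0`. -/
def ofFunction (f : C^∞⟮I, M; ℝ⟯) : EForm I F V 0 :=
  ⟨fun x => AlternatingMap.constOfIsEmpty ℝ (V x) (Fin 0) (f x), fun _ => f.contMDiff⟩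

/-- Transport of a form along an equality of degrees. -/
def castDeg {p k : ℕ} (h : p = k) (η : EForm I F V p) : EForm I F V k :=
  ⟨fun x => (η.1 x).domDomCongr (finCongr h), fun A => η.2 fun i => A (finCongr h i)⟩

/-- The exterior product of two alternating forms on a vector space,
`(α ∧ β)(v₁, …, v_{p+k}) = ∑ sgn(σ) α(v_{σ(1)}, …, v_{σ(p)}) β(v_{σ(p+1)}, …, v_{σ(p+k)})`,
the sum being over the `(p,k)`-shuffles. -/
def wedgeAlt {W : Type*} [AddCommGroup W] [Module ℝ W] {p k : ℕ}
    (α : W [⋀^Fin p]→ₗ[ℝ] ℝ) (β : W [⋀^Fin k]→ₗ[ℝ] ℝ) : W [⋀^Fin (p + k)]→ₗ[ℝ] ℝ :=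
  ((LinearMap.mul' ℝ ℝ).compAlternatingMap (α.domCoprod β)).domDomCongr finSumFinEquiv

theorem wedgeAlt_apply {W : Type*} [AddCommGroup W] [Module ℝ W] {p k : ℕ}
    (α : W [⋀^Fin p]→ₗ[ℝ] ℝ) (β : W [⋀^Fin k]→ₗ[ℝ] ℝ) (v : Fin (p + k) → W) :
    wedgeAlt α β v = ∑ σ : Equiv.Perm.ModSumCongr (Fin p) (Fin k),
      (Equiv.Perm.sign σ.out : ℤ) • (α (fun i => v (finSumFinEquiv (σ.out (Sum.inl i)))) *
        β (fun i => v (finSumFinEquiv (σ.out (Sum.inr i))))) := by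
  simp only [wedgeAlt, AlternatingMap.domDomCongr_apply, LinearMap.compAlternatingMap_apply,
    AlternatingMap.domCoprod_apply, sum_apply, map_sum]
  refine Finset.sum_congr rfl fun σ _ => ?_
  conv_lhs => rw [← Quotient.out_eq' σ]
  rw [AlternatingMap.domCoprod.summand_mk'', Units.smul_def]
  exact map_zsmul (LinearMap.mul' ℝ ℝ) _
    (MultilinearMap.domDomCongr σ.out ((α : MultilinearMap ℝ (fun _ => W) ℝ).domCoprod
      (β : MultilinearMap ℝ (fun _ => W) ℝ)) (v ∘ finSumFinEquiv))

/-- The exterior product of forms. -/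
def wedge {p k : ℕ} (α : EForm I F V p) (β : EForm I F V k) : EForm I F V (p + k) :=
  ⟨fun x => wedgeAlt (α.1 x) (β.1 x), fun A => by
    simp only [wedgeAlt_apply]
    refine contMDiff_finsetSum fun σ _ => ?_
    have h := (α.2 fun i => A (finSumFinEquiv (σ.out (Sum.inl i)))).mul
      (β.2 fun i => A (finSumFinEquiv (σ.out (Sum.inr i))))
    simp only [zsmul_eq_mul]
    exact contMDiff_const.mul h⟩

variable (I F V) in
/-- A derivation of degree `1` of `Γ(Λ V*)`: an `ℝ`-linear operator raising the degree by one, with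
`D(α ∧ β) = Dα ∧ β + (-1)ᵖ α ∧ Dβ` for `α` of degree `p`. -/
structure DerivationOne where
  toFun : ∀ p : ℕ, EForm I F V p →ₗ[ℝ] EForm I F V (p + 1)
  leibniz : ∀ (p k : ℕ) (α : EForm I F V p) (β : EForm I F V k),
    toFun (p + k) (wedge α β) =
      castDeg (Nat.add_right_comm p 1 k) (wedge (toFun p α) β) + (-1 : ℝ) ^ p • wedge α (toFun k β)

variable [VectorBundle ℝ F V]

/-- The product `f A` of a smooth function and a smooth section. -/
def fmul (f : C^∞⟮I, M; ℝ⟯) (A : Cₛ^∞⟮I; F, V⟯) : Cₛ^∞⟮I; F, V⟯ :=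
  ⟨fun x => f x • A x, f.contMDiff.smul_section A.contMDiff⟩

variable [IsManifold I ∞ M]

/-! ### Lie algebroids -/

variable (I F V) in
/-- A vector bundle map `V → TM` over the identity of `M`. -/
structure BundleMapToTangent where
  toFun : ∀ x : M, V x →L[ℝ] TangentSpace I x
  smooth : ContMDiff I (I.prod 𝓘(ℝ, F →L[ℝ] E)) ∞ fun x =>
    (TotalSpace.mk' (F →L[ℝ] E) x (toFun x) :
      TotalSpace (F →L[ℝ] E) fun x : M => V x →L[ℝ] TangentSpace I x)

/-- The function `(qA)(f)`. -/
def anchorDeriv (q : BundleMapToTangent I F V) (A : Cₛ^∞⟮I; F, V⟯) (f : M → ℝ) (x : M) : ℝ :=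
  mvfderiv I f x (q.toFun x (A x))

variable (I F V) in
/-- A Lie algebroid structure on the vector bundle `V`: an anchor `V → TM` and a Lie bracket on the
smooth sections of `V` satisfying the Leibniz rule. -/
structure LieAlgebroid where
  anchor : BundleMapToTangent I F V
  bracket : Cₛ^∞⟮I; F, V⟯ →ₗ[ℝ] Cₛ^∞⟮I; F, V⟯ →ₗ[ℝ] Cₛ^∞⟮I; F, V⟯
  bracket_self : ∀ A, bracket A A = 0
  jacobi : ∀ A B C,
    bracket A (bracket B C) + bracket B (bracket C A) + bracket C (bracket A B) = 0
  leibniz : ∀ (A B : Cₛ^∞⟮I; F, V⟯) (f : C^∞⟮I, M; ℝ⟯) (x : M),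
    bracket A (fmul f B) x = f x • bracket A B x + anchorDeriv anchor A f x • B x

/-- `D` is the differential of the Lie algebroid: on functions and on forms of degree `1` it is
given by `Df(A) = qA(f)` and `Dα(A, B) = qA(α(B)) - qB(α(A)) - α([A, B])`. -/
structure LieAlgebroid.IsDifferential (𝔞 : LieAlgebroid I F V) (D : DerivationOne I F V) :
    Prop where
  function : ∀ (f : C^∞⟮I, M; ℝ⟯) (A : Cₛ^∞⟮I; F, V⟯) (x : M),
    evalForm (D.toFun 0 (ofFunction f)) ![A] x = anchorDeriv 𝔞.anchor A f x
  oneForm : ∀ (α : EForm I F V 1) (A B : Cₛ^∞⟮I; F, V⟯) (x : M),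
    evalForm (D.toFun 1 α) ![A, B] x =
      anchorDeriv 𝔞.anchor A (evalForm α ![B]) x - anchorDeriv 𝔞.anchor B (evalForm α ![A]) x
        - evalForm α ![𝔞.bracket A B] x

/-- A connection of the Lie algebroid `𝔞` on its own vector bundle. -/
structure EConnection (𝔞 : LieAlgebroid I F V) where
  toFun : Cₛ^∞⟮I; F, V⟯ →ₗ[ℝ] Cₛ^∞⟮I; F, V⟯ →ₗ[ℝ] Cₛ^∞⟮I; F, V⟯
  fmul_left : ∀ f A B, toFun (fmul f A) B = fmul f (toFun A B)
  leibniz : ∀ (A B : Cₛ^∞⟮I; F, V⟯) (f : C^∞⟮I, M; ℝ⟯) (x : M),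
    toFun A (fmul f B) x = anchorDeriv 𝔞.anchor A f x • B x + f x • toFun A B x

/-- The torsion `δ_A B - δ_B A - [A, B]`. -/
def EConnection.torsion {𝔞 : LieAlgebroid I F V} (δ : EConnection 𝔞) (A B : Cₛ^∞⟮I; F, V⟯) :
    Cₛ^∞⟮I; F, V⟯ :=
  δ.toFun A B - δ.toFun B A - 𝔞.bracket A B

/-! ### Linear connections -/

variable [∀ x, IsTopologicalAddGroup (V x)] [∀ x, ContinuousSMul ℝ (V x)]
  [ContMDiffVectorBundle ∞ F V I]

theorem contMDiff_anchor (q : BundleMapToTangent I F V) (A : Cₛ^∞⟮I; F, V⟯) :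
    ContMDiff I I.tangent ∞ fun x => (⟨x, q.toFun x (A x)⟩ : TangentBundle I M) :=
  ContMDiff.clm_bundle_apply q.smooth A.contMDiff

theorem contMDiff_anchorDeriv (q : BundleMapToTangent I F V) (A : Cₛ^∞⟮I; F, V⟯)
    (f : C^∞⟮I, M; ℝ⟯) : ContMDiff I 𝓘(ℝ, ℝ) ∞ (anchorDeriv q A f) := by
  have h := (f.contMDiff.contMDiff_tangentMap (m := ∞) (by simp)).comp (contMDiff_anchor q A)
  have h1 := contMDiff_tangentBundleModelSpaceHomeomorph (I := 𝓘(ℝ, ℝ)) (n := ∞)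
  have h2 : ContMDiff (𝓘(ℝ, ℝ).prod 𝓘(ℝ, ℝ)) 𝓘(ℝ, ℝ) ∞ (fun v : ModelProd ℝ ℝ => v.2) := by
    have h3 := contMDiff_snd (I := 𝓘(ℝ, ℝ)) (J := 𝓘(ℝ, ℝ)) (M := ℝ) (N := ℝ) (n := ∞)
    rw [chartedSpaceSelf_prod] at h3
    exact h3
  exact h2.comp (h1.comp h)

/-- The smooth section `∇_{qA} B`. -/
def covAlong (cov : CovariantDerivative I F V) [cov.ContMDiffCovariantDerivative ∞]
    (q : BundleMapToTangent I F V) (A B : Cₛ^∞⟮I; F, V⟯) : Cₛ^∞⟮I; F, V⟯ :=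
  ⟨fun x => cov B x (q.toFun x (A x)), by
    have h := (CovariantDerivative.ContMDiffCovariantDerivative.contMDiff (cov := cov) (k := ∞)).contMDiff
      (σ := B) (by simpa using B.contMDiff.contMDiffOn)
    exact ContMDiff.clm_bundle_apply (contMDiffOn_univ.1 h) (contMDiff_anchor q A)⟩

/-- The connection `δ_A B = ∇_{qA} B` of the Lie algebroid induced by the linear connection `∇`. -/
def inducedConnection (𝔞 : LieAlgebroid I F V) (cov : CovariantDerivative I F V)
    [cov.ContMDiffCovariantDerivative ∞] : EConnection 𝔞 where
  toFun := LinearMap.mk₂ ℝ (covAlong cov 𝔞.anchor)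
    (fun A A' B => by ext x; simp [covAlong])
    (fun c A B => by ext x; simp [covAlong])
    (fun A B B' => by
      ext x
      simp [covAlong, cov.isCovariantDerivativeOnUniv.add B.mdifferentiableAt B'.mdifferentiableAt])
    (fun c A B => by
      ext x
      simp [covAlong, cov.isCovariantDerivativeOnUniv.smul_const c B.mdifferentiableAt])
  fmul_left f A B := by ext x; simp [covAlong, fmul]
  leibniz A B f x := by
    have h := cov.isCovariantDerivativeOnUniv.leibniz (B.mdifferentiableAt (x := x))
      (f.mdifferentiableAt (x := x))
    have h' := congrArg (fun L => L (𝔞.anchor.toFun x (A x))) h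
    simp only [add_apply, smul_apply, ContinuousLinearMap.smulRight_apply] at h'
    exact h'.trans (add_comm _ _)

variable [FiniteDimensional ℝ E] [FiniteDimensional ℝ F] [T2Space M]

theorem exists_section_eventuallyEq {x : M} {s : Set M} (hs : s ∈ 𝓝 x) {σ : ∀ y, V y}
    (hσ : CMDiff[s] ∞ (T% σ)) : ∃ A : Cₛ^∞⟮I; F, V⟯, ∀ᶠ y in 𝓝 x, σ y = A y := by
  obtain ⟨u, hus, hu, hxu⟩ := mem_nhds_iff.1 hs
  obtain ⟨f, -, hf⟩ := (SmoothBumpFunction.nhds_basis_tsupport (I := I) x).mem_iff.1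
    (hu.mem_nhds hxu)
  refine ⟨⟨(f : M → ℝ) • σ,
    ContMDiffOn.smul_section_of_tsupport f.contMDiff.contMDiffOn hu hf (hσ.mono hus)⟩, ?_⟩
  filter_upwards [f.eventuallyEq_one] with y hy
  simp [hy]

theorem mdifferentiableAt_form {p : ℕ} (η : EForm I F V p) {x : M} {B : Fin p → ∀ y, V y}
    (hB : ∀ i, MDifferentiableAt I (I.prod 𝓘(ℝ, F)) (fun y => (⟨y, B i y⟩ : TotalSpace F V)) x) : MDiffAt (fun y => η.1 y fun i => B i y) x := by
  have : ContMDiffVectorBundle 1 F V I := ContMDiffVectorBundle.of_le (n := ∞) (by simp)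
  let t := trivializationAt F V x
  let b := Module.finBasis ℝ F
  have hx : x ∈ t.baseSet := FiberBundle.mem_baseSet_trivializationAt' x
  choose A hA using fun k => exists_section_eventuallyEq (t.open_baseSet.mem_nhds hx)
    (t.contMDiffOn_localFrame_baseSet (I := I) ∞ b k)
  have hc : ∀ i k, MDiffAt (fun y => t.localFrameCoeff I b k y (B i y)) x := fun i k =>
    mdifferentiableAt_localFrameCoeff b hx (hB i) k
  have key : (fun y => η.1 y fun i => B i y) =ᶠ[𝓝 x]
      ∑ r : Fin p → Fin (Module.finrank ℝ F),
        (∏ i, fun y => t.localFrameCoeff I b (r i) y (B i y)) *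
          (fun y => η.1 y fun i => A (r i) y) := by
    have h1 : ∀ᶠ y in 𝓝 x, ∀ i, B i y = ∑ k, t.localFrameCoeff I b k y (B i y) • t.localFrame b k y :=
      Filter.eventually_all.2 fun i => t.eventually_eq_localFrame_sum_coeff_smul b hx
    filter_upwards [h1, Filter.eventually_all.2 hA] with y h1 h2
    conv_lhs => rw [show (fun i => B i y) = _ from funext h1]
    rw [← AlternatingMap.coe_multilinearMap, MultilinearMap.map_sum]
    simp only [h2, MultilinearMap.map_smul_univ, Finset.sum_apply, Pi.mul_apply, Finset.prod_apply,
      smul_eq_mul, AlternatingMap.coe_multilinearMap]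
  refine MDifferentiableAt.congr_of_eventuallyEq ?_ key
  refine MDifferentiableAt.sum fun r _ => ?_
  refine MDifferentiableAt.mul (MDifferentiableAt.prod fun i _ => hc i (r i)) ?_
  exact (η.2 fun i => A (r i)).mdifferentiableAt (by simp)

/-- The expression `X(η(B₁, …, Bₚ)) - ∑ⱼ η(B₁, …, ∇_X Bⱼ, …, Bₚ)` at `x`, where `X` has value `v`
at `x`. -/
def covFormAux (cov : CovariantDerivative I F V) {p : ℕ} (η : EForm I F V p) (x : M)
    (v : TangentSpace I x) (B : Fin p → ∀ y, V y) : ℝ :=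
  mvfderiv I (fun y => η.1 y fun i => B i y) x v
    - ∑ j, η.1 x (update (fun i => B i x) j (cov (B j) x v))

theorem covFormAux_tensorial (cov : CovariantDerivative I F V) {p : ℕ} (η : EForm I F V p) (x : M)
    (v : TangentSpace I x) {B : Fin p → ∀ y, V y} (hB : ∀ i, MDifferentiableAt I (I.prod 𝓘(ℝ, F)) (fun y => (⟨y, B i y⟩ : TotalSpace F V)) x) (i : Fin p) :
    TensorialAt I F (fun σ => covFormAux cov η x v (update B i σ)) x := by
  have hev : ∀ (σ : ∀ y, V y) y, (fun k => update B i σ k y) = update (fun k => B k y) i (σ y) := by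
    intro σ y; ext k
    by_cases h : k = i
    · subst h; simp
    · simp [h]
  have hd : ∀ {σ : ∀ y, V y}, MDiffAt (T% σ) x →
      MDiffAt (fun y => η.1 y (update (fun k => B k y) i (σ y))) x := by
    intro σ hσ
    simp only [← hev]
    refine mdifferentiableAt_form η fun k => ?_
    by_cases h : k = i
    · subst h; simpa using hσ
    · simpa [h] using hB k
  have hsum : ∀ σ : ∀ y, V y, covFormAux cov η x v (update B i σ) =
      mvfderiv I (fun y => η.1 y (update (fun k => B k y) i (σ y))) x v
      - (η.1 x (update (fun k => B k x) i (cov σ x v)) + ∑ j ∈ Finset.univ.erase i,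
        η.1 x (update (update (fun k => B k x) j (cov (B j) x v)) i (σ x))) := by
    intro σ
    rw [covFormAux, ← Finset.add_sum_erase _ _ (Finset.mem_univ i)]
    simp only [hev, update_self, update_idem]
    congr 2
    refine Finset.sum_congr rfl fun j hj => ?_
    have hj := Finset.ne_of_mem_erase hj
    rw [update_of_ne hj, update_comm hj]
  constructor
  · intro f σ hf hσ
    have e : (fun y => η.1 y (update (fun k => B k y) i ((f • σ) y))) =
        f • fun y => η.1 y (update (fun k => B k y) i (σ y)) := by
      ext y; simp
    rw [hsum, hsum, e, mvfderiv_smul hf (hd hσ), cov.isCovariantDerivativeOnUniv.leibniz hσ hf]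
    simp [← Finset.mul_sum]
    ring
  · intro σ τ hσ hτ
    have e : (fun y => η.1 y (update (fun k => B k y) i ((σ + τ) y))) =
        (fun y => η.1 y (update (fun k => B k y) i (σ y))) +
          fun y => η.1 y (update (fun k => B k y) i (τ y)) := by
      ext y; simp
    rw [hsum, hsum, hsum, e, mvfderiv_add (hd hσ) (hd hτ), cov.isCovariantDerivativeOnUniv.add hσ hτ]
    simp [Finset.sum_add_distrib]
    ring


theorem extend_update {x : M} {p : ℕ} (b : Fin p → V x) (i : Fin p) (u : V x) :
    (fun k => FiberBundle.extend F (update b i u k)) =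
      update (fun k => FiberBundle.extend F (b k)) i (FiberBundle.extend F u) := by
  ext k
  by_cases h : k = i
  · subst h; simp
  · simp [h]

/-- The covariant derivative `∇_v η` of a form, as an alternating form on the fibre at `x`:
`(∇_v η)(b₁, …, bₚ) = v(η(B₁, …, Bₚ)) - ∑ⱼ η(b₁, …, ∇_v Bⱼ, …, bₚ)`, where the `Bⱼ` are any smooth
sections with `Bⱼ x = bⱼ`. -/
def covForm (cov : CovariantDerivative I F V) {p : ℕ} (η : EForm I F V p) (x : M) :
    TangentSpace I x →ₗ[ℝ] V x [⋀^Fin p]→ₗ[ℝ] ℝ where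
  toFun v :=
    { toFun := fun b => covFormAux cov η x v fun i => FiberBundle.extend F (b i)
      map_update_add' := by
        intro inst b i u w
        rw [Subsingleton.elim inst (instDecidableEqFin p)]
        have : ContMDiffVectorBundle 1 F V I := ContMDiffVectorBundle.of_le (n := ∞) (by simp)
        have T := covFormAux_tensorial cov η x v
          (B := fun k => FiberBundle.extend F (b k)) (fun k => FiberBundle.mdifferentiableAt_extend I F (b k)) i
        simp only [extend_update]
        exact map_add (TensorialAt.mkHom _ x T) u w
      map_update_smul' := by
        intro inst b i c u
        rw [Subsingleton.elim inst (instDecidableEqFin p)]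
        have : ContMDiffVectorBundle 1 F V I := ContMDiffVectorBundle.of_le (n := ∞) (by simp)
        have T := covFormAux_tensorial cov η x v
          (B := fun k => FiberBundle.extend F (b k)) (fun k => FiberBundle.mdifferentiableAt_extend I F (b k)) i
        simp only [extend_update]
        exact map_smul (TensorialAt.mkHom _ x T) c u
      map_eq_zero_of_eq' := by
        intro b i j hb hij
        have h0 : (fun y => η.1 y fun k => FiberBundle.extend F (b k) y) = fun _ => 0 := by
          ext y
          exact (η.1 y).map_eq_zero_of_eq _ (by simp [hb]) hij
        simp only [covFormAux, h0, mvfderiv_const, FiberBundle.extend_apply_self,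
          zero_apply, zero_sub, neg_eq_zero]
        rw [Fintype.sum_eq_add i j hij, hb]
        · have e : (update b j (cov (FiberBundle.extend F (b j)) x v)) =
              update b i (cov (FiberBundle.extend F (b j)) x v) ∘ Equiv.swap i j := by
            ext k
            by_cases h : k = i
            · subst h; simp [hij, hij.symm, hb]
            by_cases h' : k = j
            · subst h'; simp
            simp [h, h', Equiv.swap_apply_of_ne_of_ne]
          rw [e]
          exact (η.1 x).map_add_swap _ hij
        · rintro k ⟨hi, hj⟩
          exact (η.1 x).map_eq_zero_of_eq _ (by simp [hi.symm, hj.symm, hb]) hij }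
  map_add' v w := by
    ext b
    simp only [covFormAux, map_add, AlternatingMap.map_update_add, Finset.sum_add_distrib,
      AlternatingMap.add_apply, AlternatingMap.coe_mk, MultilinearMap.coe_mk]
    ring
  map_smul' c v := by
    ext b
    simp only [covFormAux, map_smul, AlternatingMap.map_update_smul, ← Finset.smul_sum,
      AlternatingMap.smul_apply, AlternatingMap.coe_mk, MultilinearMap.coe_mk, RingHom.id_apply,
      smul_sub]

theorem covForm_apply (cov : CovariantDerivative I F V) {p : ℕ} (η : EForm I F V p) (x : M)
    (v : TangentSpace I x) (B : Fin p → Cₛ^∞⟮I; F, V⟯) :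
    covForm cov η x v (fun i => B i x) = covFormAux cov η x v fun i => B i := by
  have : ContMDiffVectorBundle 1 F V I := ContMDiffVectorBundle.of_le (n := ∞) (by simp)
  have key : ∀ s : Finset (Fin p),
      covFormAux cov η x v (fun i => FiberBundle.extend F (B i x)) =
        covFormAux cov η x v fun i => if i ∈ s then B i else FiberBundle.extend F (B i x) := by
    intro s
    induction s using Finset.induction_on with
    | empty => simp
    | insert a s ha ih =>
      rw [ih]
      set C : Fin p → ∀ y, V y := fun i => if i ∈ s then B i else FiberBundle.extend F (B i x)
        with hC
      have hCd : ∀ i, MDifferentiableAt I (I.prod 𝓘(ℝ, F))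
          (fun y => (⟨y, C i y⟩ : TotalSpace F V)) x := by
        intro i
        by_cases h : i ∈ s
        · simpa [hC, h] using (B i).mdifferentiableAt
        · simpa [hC, h] using FiberBundle.mdifferentiableAt_extend I F (B i x)
      have T := (covFormAux_tensorial cov η x v hCd a).pointwise
        (FiberBundle.mdifferentiableAt_extend I F (B a x)) (B a).mdifferentiableAt (by simp)
      have e1 : update C a (FiberBundle.extend F (B a x)) = C := by
        rw [update_eq_self_iff]; simp [hC, ha]
      have e2 : update C a (B a) =
          fun i => if i ∈ insert a s then ⇑(B i) else FiberBundle.extend F (B i x) := by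
        ext i
        by_cases h : i = a
        · subst h; simp
        · simp [h, hC]
      rw [← e2, ← T, e1]
  have h := key Finset.univ
  simp only [Finset.mem_univ, if_true] at h
  exact h

/-- The operator `∇_q` on forms, for a bundle map `q : V → TM` and a linear connection `∇`:
`(∇_q η)(A₀, …, Aₚ) = ∑ᵢ (-1)ⁱ (∇_{qAᵢ} η)(A₀, …, Âᵢ, …, Aₚ)`. -/
def nablaForm (cov : CovariantDerivative I F V) [cov.ContMDiffCovariantDerivative ∞]
    (q : BundleMapToTangent I F V) {p : ℕ} (η : EForm I F V p) : EForm I F V (p + 1) :=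
  ⟨fun x => AlternatingMap.alternatizeUncurryFin (covForm cov η x ∘ₗ (q.toFun x).toLinearMap), by
    intro A
    have e : ∀ x, AlternatingMap.alternatizeUncurryFin
        (covForm cov η x ∘ₗ (q.toFun x).toLinearMap) (fun i => A i x) =
        ∑ i : Fin (p + 1), (-1 : ℝ) ^ (i : ℕ) *
          (anchorDeriv q (A i) (evalForm η (i.removeNth A)) x -
            ∑ j, evalForm η (update (i.removeNth A) j (covAlong cov q (A i) (i.removeNth A j))) x) := by
      intro x
      rw [AlternatingMap.alternatizeUncurryFin_apply]
      refine Finset.sum_congr rfl fun i _ => ?_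
      rw [zsmul_eq_mul]
      push_cast
      congr 1
      refine (covForm_apply cov η x (q.toFun x (A i x)) (i.removeNth A)).trans ?_
      rw [covFormAux]
      congr 1
      refine Finset.sum_congr rfl fun j _ => ?_
      refine congrArg (η.1 x) ?_
      ext k
      by_cases h : k = j
      · subst h; simp [covAlong]
      · simp [h]
    simp only [e]
    refine contMDiff_finsetSum fun i _ => contMDiff_const.mul ?_
    exact (contMDiff_anchorDeriv q (A i) _).sub
      (contMDiff_finsetSum fun j _ => (evalForm η _).contMDiff)⟩

/-- The insertion of an alternating bilinear map `L : W × W → W` into an alternating form. -/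
def insertAlt {W : Type*} [AddCommGroup W] [Module ℝ W] (L : W [⋀^Fin 2]→ₗ[ℝ] W) :
    ∀ {p : ℕ}, (W [⋀^Fin p]→ₗ[ℝ] ℝ) → W [⋀^Fin (p + 1)]→ₗ[ℝ] ℝ
  | 0, _ => 0
  | _ + 1, η => (1 / 2 : ℝ) • AlternatingMap.alternatizeUncurryFin
      (AlternatingMap.alternatizeUncurryFinLM ∘ₗ LinearMap.mk₂ ℝ
        (fun a b => η.curryLeft (L ![a, b]))
        (fun a a' b => by rw [← map_add]; congr 1; exact L.map_vecCons_add _ _ _)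
        (fun c a b => by rw [← map_smul]; congr 1; exact L.map_vecCons_smul _ _ _)
        (fun a b b' => by
          rw [← map_add]; congr 1
          exact (L.curryLeft a).map_vecCons_add ![] b b')
        (fun c a b => by
          rw [← map_smul]; congr 1
          exact (L.curryLeft a).map_vecCons_smul ![] c b))

/-- The usual formula for the insertion, as a sum over the pairs `i < j + 1`, that is over the
`(2, p)`-shuffles:
`∑ (-1)^(i+j) η(L(vᵢ, v_{j+1}), v₀, …, v̂ᵢ, …, v̂_{j+1}, …, v_{p+1})`. -/
theorem insertAlt_apply {W : Type*} [AddCommGroup W] [Module ℝ W] (L : W [⋀^Fin 2]→ₗ[ℝ] W)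
    {p : ℕ} (η : W [⋀^Fin (p + 1)]→ₗ[ℝ] ℝ) (v : Fin (p + 2) → W) :
    insertAlt L η v = ∑ i : Fin (p + 1), ∑ j ≥ i, (-1 : ℝ) ^ (i + j : ℕ) *
      η (Matrix.vecCons (L ![v i.castSucc, v j.succ]) (j.removeNth (i.castSucc.removeNth v))) := by
  have hL : ∀ a b : W, L ![b, a] = - L ![a, b] := by
    intro a b
    have := L.map_swap ![a, b] (i := 0) (j := 1) (by simp)
    rw [← this]
    congr 1
    ext k; fin_cases k <;> simp
  simp only [insertAlt, AlternatingMap.smul_apply,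
    AlternatingMap.alternatizeUncurryFin_alternatizeUncurryFinLM_comp_apply, LinearMap.mk₂_apply,
    Finset.smul_sum]
  refine Finset.sum_congr rfl fun i _ => Finset.sum_congr rfl fun j _ => ?_
  rw [hL (v i.castSucc) (v j.succ), map_neg]
  simp only [AlternatingMap.neg_apply, AlternatingMap.curryLeft_apply_apply, sub_neg_eq_add,
    zsmul_eq_mul, smul_eq_mul]
  push_cast
  ring

/-- The insertion operator `ι_L` of a form `L ∈ Γ(Λ² V* ⊗ V)`. -/
def insertion (L : EValuedForm I F V 2) : ∀ {p : ℕ}, EForm I F V p → EForm I F V (p + 1)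
  | 0, η => ⟨fun x => insertAlt (L.toFun x) (η.1 x), fun _ => contMDiff_const⟩
  | p + 1, η => ⟨fun x => insertAlt (L.toFun x) (η.1 x), fun A => by
      simp only [insertAlt_apply]
      refine contMDiff_finsetSum fun i _ => contMDiff_finsetSum fun j _ => contMDiff_const.mul ?_
      convert (evalForm η (Matrix.vecCons (EValuedForm.eval L ![A i.castSucc, A j.succ])
        (j.removeNth (i.castSucc.removeNth A)))).contMDiff using 2 with x
      refine congrArg (η.1 x) ?_
      ext k
      refine Fin.cases ?_ (fun k => ?_) k
      · refine congrArg (L.toFun x) ?_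
        ext l; fin_cases l <;> rfl
      · rfl⟩

end LieAlgd

end

/-!
A derivation of degree one is determined by its values on functions and one-forms. Indeed, let `ρ`
be a bump function and let `e_k`, `θ_k` be a local frame with its coframe, both cut off so that
`∑ θ_k(b) e_k = ρ b`. A form `η` of degree `p > 0` then satisfies `p ρ η = ∑ θ_k ∧ ι_{e_k} η`, and
induction on the degree gives the uniqueness of `D`.

Conversely, `∇_q` and `ι_L` are both derivations: each is an alternation, over one or two arguments,
of an operation compatible with the wedge product (a covariant derivative, or the contraction with
`L(a, b)`). The torsion is `C^∞(M)`-bilinear, hence given by a tensor `L`, and `∇_q + ι_L` has the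
values of `D` on functions and one-forms: the term `-α(⟦A, B⟧)` is what remains of `α(L(A, B))`
after cancelling the derivatives `α(∇_{qA} B)` and `α(∇_{qB} A)`.
-/

noncomputable section

namespace LieAlgd

section Cochain

variable {R : Type*} [CommRing R] {W : Type*}

variable (R W) in
/-- Cochains of all degrees at once: a form of degree `p` is a function on lists of arguments which
is supported on the lists of length `p`. Identities between forms of degrees such as `p + 1 + k` and
`p + k + 1` then need no transport. -/
abbrev Cochain : Type _ := List W → R

namespace Cochain

/-- The contraction `ι_x`, which plugs `x` into the first argument. -/
def contract (x : W) : Cochain R W →ₗ[R] Cochain R W :=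
  LinearMap.funLeft R R (List.cons x)

@[simp]
theorem contract_apply (x : W) (φ : Cochain R W) (l : List W) : contract x φ l = φ (x :: l) :=
  rfl

/-- The grading involution `φ ↦ (-1)^{deg φ} φ`. -/
def parity : Cochain R W →ₗ[R] Cochain R W :=
  LinearMap.mulLeft R fun l => (-1) ^ l.length

@[simp]
theorem parity_apply (φ : Cochain R W) (l : List W) : parity φ l = (-1) ^ l.length * φ l :=
  rfl

theorem contract_parity (x : W) (φ : Cochain R W) :
    contract x (parity φ) = -parity (contract x φ) := by
  ext l
  simp [pow_succ]

theorem parity_parity (φ : Cochain R W) : parity (parity φ) = φ := by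
  ext l
  rw [parity_apply, parity_apply, ← mul_assoc, ← mul_pow, neg_one_mul, neg_neg, one_pow, one_mul]

/-- The exterior product `φ ∧ ψ` evaluated at a list, computed by the contraction rule
`ι_x (φ ∧ ψ) = ι_x φ ∧ ψ + (-1)^{deg φ} φ ∧ ι_x ψ`. -/
def wedgeAt : List W → Cochain R W →ₗ[R] Cochain R W →ₗ[R] R
  | [] => (LinearMap.mul R R).compl₁₂ (LinearMap.proj []) (LinearMap.proj [])
  | x :: l => wedgeAt l ∘ₗ contract x + (wedgeAt l).compl₁₂ parity (contract x)

/-- The exterior product of cochains. -/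
def wedge : Cochain R W →ₗ[R] Cochain R W →ₗ[R] Cochain R W :=
  LinearMap.mk₂ R (fun φ ψ l => wedgeAt l φ ψ) (fun _ _ _ => by ext; simp)
    (fun _ _ _ => by ext; simp) (fun _ _ _ => by ext; simp) (fun _ _ _ => by ext; simp)

@[simp]
theorem wedge_nil (φ ψ : Cochain R W) : wedge φ ψ [] = φ [] * ψ [] :=
  rfl

theorem wedge_cons (φ ψ : Cochain R W) (x : W) (l : List W) :
    wedge φ ψ (x :: l) = wedge (contract x φ) ψ l + wedge (parity φ) (contract x ψ) l :=
  rfl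

/-- The alternating sum `∑ᵢ (-1)ⁱ a(xᵢ)(x₀, …, x̂ᵢ, …)` evaluated at the list of the `xᵢ`. -/
def alternationAt : List W → (W → Cochain R W) →ₗ[R] R
  | [] => 0
  | x :: l => (LinearMap.proj l : Cochain R W →ₗ[R] R) ∘ₗ LinearMap.proj x -
      alternationAt l ∘ₗ (contract x).compLeft W

/-- The alternating sum `∑ᵢ (-1)ⁱ a(xᵢ)(x₀, …, x̂ᵢ, …)` as a cochain in the `xᵢ`. -/
def alternation : (W → Cochain R W) →ₗ[R] Cochain R W :=
  LinearMap.pi alternationAt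

@[simp]
theorem alternation_nil (a : W → Cochain R W) : alternation a [] = 0 :=
  rfl

theorem alternation_cons (a : W → Cochain R W) (x : W) (l : List W) :
    alternation a (x :: l) = a x l - alternation (fun y => contract x (a y)) l :=
  rfl

theorem contract_alternation (a : W → Cochain R W) (x : W) :
    contract x (alternation a) = a x - alternation fun y => contract x (a y) :=
  rfl

theorem alternation_parity (a : W → Cochain R W) :
    (alternation fun y => parity (a y)) = -parity (alternation a) := by
  ext l
  induction l generalizing a with
  | nil => simp
  | cons x l ih =>
    have h := ih fun y => -contract x (a y)
    simp only [map_neg] at h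
    simp only [alternation_cons, contract_parity, h, Pi.neg_apply, parity_apply, List.length_cons]
    rw [show (fun y => -contract x (a y)) = -fun y => contract x (a y) from rfl, map_neg]
    simp only [Pi.neg_apply, pow_succ]
    ring

theorem alternation_wedge_left (a : W → Cochain R W) (ψ : Cochain R W) :
    (alternation fun y => wedge (a y) ψ) = wedge (alternation a) ψ := by
  ext l
  induction l generalizing a ψ with
  | nil => simp
  | cons x l ih =>
    have hcontract : (fun y => contract x (wedge (a y) ψ)) =
        (fun y => wedge (contract x (a y)) ψ) + fun y => wedge (parity (a y)) (contract x ψ) := rfl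
    rw [alternation_cons, hcontract, map_add, Pi.add_apply, ih, ih, alternation_parity, wedge_cons,
      contract_alternation, map_sub, map_neg]
    simp only [LinearMap.sub_apply, LinearMap.neg_apply, Pi.sub_apply, Pi.neg_apply]
    ring

theorem alternation_wedge_right (φ : Cochain R W) (b : W → Cochain R W) :
    (alternation fun y => wedge φ (b y)) = wedge (parity φ) (alternation b) := by
  ext l
  induction l generalizing φ b with
  | nil => simp
  | cons x l ih =>
    have hcontract : (fun y => contract x (wedge φ (b y))) =
        (fun y => wedge (contract x φ) (b y)) + fun y => wedge (parity φ) (contract x (b y)) := rfl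
    rw [alternation_cons, hcontract, map_add, Pi.add_apply, ih, ih, wedge_cons, contract_parity,
      parity_parity, contract_alternation, map_sub, map_neg]
    simp only [LinearMap.neg_apply, Pi.sub_apply, Pi.neg_apply]
    ring

theorem wedge_of_contract_eq_zero {φ : Cochain R W} (hφ : ∀ x, contract x φ = 0)
    (ψ : Cochain R W) : wedge φ ψ = φ [] • ψ := by
  have hparity : parity φ = φ := by
    ext l
    cases l with
    | nil => simp
    | cons x l =>
      have hcons : φ (x :: l) = 0 := congrFun (hφ x) l
      rw [parity_apply, hcons, mul_zero]
  ext l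
  induction l generalizing ψ with
  | nil => simp
  | cons x l ih =>
    rw [wedge_cons, hφ, hparity, ih, map_zero]
    simp

/-- Twice the insertion of a skew map `L` into a cochain: the insertion sums over the pairs `i < j`
of arguments, while this sum runs over all ordered pairs. -/
def pairInsertion (L : W → W → W) : Cochain R W →ₗ[R] Cochain R W :=
  alternation ∘ₗ LinearMap.pi fun a => alternation ∘ₗ LinearMap.pi fun b => contract (L a b)

theorem pairInsertion_apply (L : W → W → W) (φ : Cochain R W) :
    pairInsertion L φ = alternation fun a => alternation fun b => contract (L a b) φ :=
  rfl

theorem pairInsertion_wedge (L : W → W → W) (φ ψ : Cochain R W) :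
    pairInsertion L (wedge φ ψ) =
      wedge (pairInsertion L φ) ψ + wedge (parity φ) (pairInsertion L ψ) := by
  have hinner : ∀ a, (alternation fun b => contract (L a b) (wedge φ ψ)) =
      wedge (alternation fun b => contract (L a b) φ) ψ +
        wedge φ (alternation fun b => contract (L a b) ψ) := fun a => by
    have hcontract : (fun b => contract (L a b) (wedge φ ψ)) =
        (fun b => wedge (contract (L a b) φ) ψ) +
          fun b => wedge (parity φ) (contract (L a b) ψ) := rfl
    rw [hcontract, map_add, alternation_wedge_left, alternation_wedge_right, parity_parity]
  rw [pairInsertion_apply, funext hinner, ← Pi.add_def, map_add, alternation_wedge_left,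
    alternation_wedge_right, pairInsertion_apply, pairInsertion_apply]

end Cochain

end Cochain

section OfAlternating

variable {R : Type*} [CommRing R] {W : Type*} [AddCommGroup W] [Module R W]

namespace Cochain

/-- An alternating form as a cochain, with the value zero on the lists of the wrong length. -/
def ofAlternating {p : ℕ} : (W [⋀^Fin p]→ₗ[R] R) →ₗ[R] Cochain R W where
  toFun η l := if l.length = p then η fun i => l.getD i 0 else 0
  map_add' η η' := by ext l; by_cases h : l.length = p <;> simp [h]
  map_smul' c η := by ext l; by_cases h : l.length = p <;> simp [h]

theorem ofAlternating_apply {p : ℕ} (η : W [⋀^Fin p]→ₗ[R] R) (l : List W) :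
    ofAlternating η l = if l.length = p then η fun i => l.getD i 0 else 0 :=
  rfl

@[simp]
theorem ofAlternating_ofFn {p : ℕ} (η : W [⋀^Fin p]→ₗ[R] R) (v : Fin p → W) :
    ofAlternating η (List.ofFn v) = η v := by
  simp [ofAlternating_apply]

theorem ofAlternating_injective {p : ℕ} :
    Injective (ofAlternating : (W [⋀^Fin p]→ₗ[R] R) →ₗ[R] Cochain R W) := by
  intro η η' h
  ext v
  rw [← ofAlternating_ofFn, h, ofAlternating_ofFn]

theorem ofAlternating_domDomCongr_finCongr {p k : ℕ} (h : p = k) (η : W [⋀^Fin p]→ₗ[R] R) :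
    ofAlternating (η.domDomCongr (finCongr h)) = ofAlternating η := by
  subst h
  rfl

theorem contract_ofAlternating_zero (η : W [⋀^Fin 0]→ₗ[R] R) (x : W) :
    contract x (ofAlternating η) = 0 := by
  ext l
  simp [ofAlternating_apply]

theorem ofAlternating_zero_nil (η : W [⋀^Fin 0]→ₗ[R] R) : ofAlternating η [] = η ![] := by
  rw [ofAlternating_apply, if_pos List.length_nil]
  exact congrArg η (Subsingleton.elim _ _)

theorem contract_ofAlternating_succ {p : ℕ} (η : W [⋀^Fin (p + 1)]→ₗ[R] R) (x : W) :
    contract x (ofAlternating η) = ofAlternating (η.curryLeft x) := by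
  ext l
  simp only [contract_apply, ofAlternating_apply, List.length_cons, Nat.add_right_cancel_iff]
  split_ifs
  · rw [AlternatingMap.curryLeft_apply_apply]
    congr 1
    ext i
    cases i using Fin.cases <;> simp
  · rfl

theorem parity_ofAlternating {p : ℕ} (η : W [⋀^Fin p]→ₗ[R] R) :
    parity (ofAlternating η) = (-1 : R) ^ p • ofAlternating η := by
  ext l
  by_cases h : l.length = p <;> simp [ofAlternating_apply, h]

theorem curryLeft_alternatizeUncurryFin {p : ℕ} (a : W →ₗ[R] W [⋀^Fin (p + 1)]→ₗ[R] R) (x : W) :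
    (AlternatingMap.alternatizeUncurryFin a).curryLeft x = a x -
      AlternatingMap.alternatizeUncurryFin
        (LinearMap.applyₗ x ∘ₗ AlternatingMap.curryLeftLinearMap ∘ₗ a) := by
  ext v
  rw [AlternatingMap.curryLeft_apply_apply, AlternatingMap.alternatizeUncurryFin_apply,
    Fin.sum_univ_succ, AlternatingMap.sub_apply, AlternatingMap.alternatizeUncurryFin_apply,
    sub_eq_add_neg, ← Finset.sum_neg_distrib]
  congr 1
  · simp [Matrix.vecCons]
  · refine Finset.sum_congr rfl fun i _ => ?_
    have hremove : i.succ.removeNth (Matrix.vecCons x v) =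
        Matrix.vecCons x (i.removeNth v) := by
      ext j
      cases j using Fin.cases <;> simp [Fin.removeNth]
    simp [pow_succ, hremove]

theorem ofAlternating_alternatizeUncurryFin {p : ℕ} (a : W →ₗ[R] W [⋀^Fin p]→ₗ[R] R) :
    ofAlternating (AlternatingMap.alternatizeUncurryFin a) =
      alternation fun y => ofAlternating (a y) := by
  ext l
  induction l generalizing p with
  | nil => simp [ofAlternating_apply]
  | cons x l ih =>
    rw [← contract_apply x (ofAlternating _), contract_ofAlternating_succ, alternation_cons]
    cases p with
    | zero =>
      have hcurry : (AlternatingMap.alternatizeUncurryFin a).curryLeft x = a x := by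
        ext v
        simp [AlternatingMap.alternatizeUncurryFin_apply]
      simp only [contract_ofAlternating_zero, hcurry]
      rw [← Pi.zero_def, map_zero, Pi.zero_apply, sub_zero]
    | succ p =>
      simp only [curryLeft_alternatizeUncurryFin, map_sub, Pi.sub_apply, ih,
        contract_ofAlternating_succ]
      rfl

theorem alternation_contract_ofAlternating {p : ℕ} (η : W [⋀^Fin p]→ₗ[R] R) :
    (alternation fun y => contract y (ofAlternating η)) = (p : R) • ofAlternating η := by
  cases p with
  | zero =>
    simp only [contract_ofAlternating_zero, Nat.cast_zero, zero_smul]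
    exact map_zero _
  | succ p =>
    have h := ofAlternating_alternatizeUncurryFin η.curryLeft
    rw [AlternatingMap.alternatizeUncurryFin_curryLeft, map_nsmul] at h
    simp only [contract_ofAlternating_succ, ← h, Nat.cast_smul_eq_nsmul]

theorem wedge_ofAlternating_one (θ : W [⋀^Fin 1]→ₗ[R] R) (φ : Cochain R W) :
    wedge (ofAlternating θ) φ = alternation fun y => θ ![y] • φ := by
  have heuler := alternation_contract_ofAlternating θ
  rw [Nat.cast_one, one_smul] at heuler
  have hcontract : ∀ y, wedge (contract y (ofAlternating θ)) φ = θ ![y] • φ := fun y => by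
    rw [contract_ofAlternating_succ, wedge_of_contract_eq_zero (contract_ofAlternating_zero _),
      ofAlternating_zero_nil, AlternatingMap.curryLeft_apply_apply]
  rw [← heuler, ← alternation_wedge_left, funext hcontract]

theorem sum_wedge_contract_ofAlternating {ι : Type*} [Fintype ι] {θ : ι → W [⋀^Fin 1]→ₗ[R] R}
    {e : ι → W} {c : R} (h : ∀ b, ∑ k, θ k ![b] • e k = c • b) {p : ℕ}
    (η : W [⋀^Fin (p + 1)]→ₗ[R] R) :
    ∑ k, wedge (ofAlternating (θ k)) (contract (e k) (ofAlternating η)) =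
      (p + 1 : R) • c • ofAlternating η := by
  have hcontract : ∀ b, ∑ k, θ k ![b] • contract (e k) (ofAlternating η) =
      c • contract b (ofAlternating η) := fun b => by
    simp only [contract_ofAlternating_succ, ← map_smul, ← map_sum, h]
  have hsum : (∑ k, fun b => θ k ![b] • contract (e k) (ofAlternating η)) =
      c • fun b => contract b (ofAlternating η) := by
    ext1 b
    rw [Finset.sum_apply, hcontract, Pi.smul_apply]
  simp only [wedge_ofAlternating_one]
  rw [← map_sum, hsum, map_smul, alternation_contract_ofAlternating, smul_comm, Nat.cast_succ]

end Cochain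

theorem alternatization_domDomCongr {ι κ N : Type*} [Fintype ι] [DecidableEq ι] [Fintype κ]
    [DecidableEq κ] [AddCommGroup N] [Module R N] (e : ι ≃ κ)
    (g : MultilinearMap R (fun _ : ι => W) N) :
    MultilinearMap.alternatization (g.domDomCongr e) =
      (MultilinearMap.alternatization g).domDomCongr e := by
  ext v
  simp only [AlternatingMap.domDomCongr_apply, MultilinearMap.alternatization_apply]
  refine Fintype.sum_equiv e.symm.permCongr _ _ fun σ => ?_
  rw [Equiv.Perm.sign_permCongr]
  congr 1
  simp [comp_def, Equiv.permCongr_apply]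

/-- The linear map `x ↦ Alt (ι_x g)`, where `Alt` is the sum over all permutations of the arguments
with signs. -/
def alternatizeCurryLeft {n : ℕ} (g : MultilinearMap R (fun _ : Fin (n + 1) => W) R) :
    W →ₗ[R] W [⋀^Fin n]→ₗ[R] R where
  toFun x := MultilinearMap.alternatization (g.curryLeft x)
  map_add' x y := by rw [map_add, map_add]
  map_smul' c x := by
    ext v
    simp [MultilinearMap.alternatization_apply, Finset.mul_sum, mul_smul_comm]

theorem alternatization_eq_alternatizeUncurryFin {n : ℕ}
    (g : MultilinearMap R (fun _ : Fin (n + 1) => W) R) :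
    MultilinearMap.alternatization g =
      AlternatingMap.alternatizeUncurryFin (alternatizeCurryLeft g) := by
  ext v
  let e : Fin (n + 1) × Equiv.Perm (Fin n) → Equiv.Perm (Fin (n + 1)) := fun z =>
    z.1.cycleRange.symm * Equiv.Perm.decomposeFin.symm (0, z.2)
  have he_zero : ∀ z, e z 0 = z.1 := fun z => by simp [e]
  have he_inj : Injective e := by
    rintro ⟨i, ρ⟩ ⟨j, τ⟩ h
    obtain rfl : i = j := by simpa only [he_zero] using congrArg (· 0) h
    simpa using mul_left_cancel h
  have he : Bijective e := (Fintype.bijective_iff_injective_and_card e).2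
    ⟨he_inj, by simp [Fintype.card_perm, Nat.factorial_succ]⟩
  have hsign : ∀ z, Equiv.Perm.sign (e z) = (-1) ^ (z.1 : ℕ) * Equiv.Perm.sign z.2 := fun z => by
    simp [e, Equiv.Perm.decomposeFin.symm_sign]
  have hcurry : ∀ z, g (v ∘ e z) = g.curryLeft (v z.1) (z.1.removeNth v ∘ z.2) := fun z => by
    rw [MultilinearMap.curryLeft_apply]
    congr 1
    ext k
    cases k using Fin.cases <;> simp [e, Fin.removeNth]
  rw [AlternatingMap.alternatizeUncurryFin_apply, MultilinearMap.alternatization_apply]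
  simp only [alternatizeCurryLeft, LinearMap.coe_mk, AddHom.coe_mk,
    MultilinearMap.alternatization_apply, Finset.smul_sum, MultilinearMap.domDomCongr_apply]
  rw [← Fintype.sum_prod_type']
  refine (Fintype.sum_bijective e he _ _ fun z => ?_).symm
  rw [hsign, mul_smul, Units.smul_def ((-1) ^ (z.1 : ℕ))]
  push_cast
  exact congrArg (fun t => (-1 : ℤ) ^ (z.1 : ℕ) • Equiv.Perm.sign z.2 • t) (hcurry z).symm

/-- The product of the value of `α` at the first `p` and of `β` at the last `k` of `n = p + k`
arguments. -/
def splitMul {n p k : ℕ} (h : p + k = n) (α : W [⋀^Fin p]→ₗ[R] R) (β : W [⋀^Fin k]→ₗ[R] R) :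
    MultilinearMap R (fun _ : Fin n => W) R :=
  ((LinearMap.mul' R R).compMultilinearMap
    ((α : MultilinearMap R (fun _ => W) R).domCoprod
      (β : MultilinearMap R (fun _ => W) R))).domDomCongr (finSumFinEquiv.trans (finCongr h))

theorem splitMul_apply {n p k : ℕ} (h : p + k = n) (α : W [⋀^Fin p]→ₗ[R] R)
    (β : W [⋀^Fin k]→ₗ[R] R) (v : Fin n → W) :
    splitMul h α β v =
      α (fun i => v (Fin.cast h (Fin.castAdd k i))) *
        β (fun j => v (Fin.cast h (Fin.natAdd p j))) := by
  simp [splitMul, MultilinearMap.domCoprod_apply]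

theorem alternatization_splitMul_zero_left {k : ℕ} (h : 0 + k = k) (α : W [⋀^Fin 0]→ₗ[R] R)
    (β : W [⋀^Fin k]→ₗ[R] R) :
    MultilinearMap.alternatization (splitMul h α β) = α ![] • (k.factorial : R) • β := by
  have hβ := congrArg (α ![] • ·) β.coe_alternatization
  simp only [Fintype.card_fin, ← Nat.cast_smul_eq_nsmul R] at hβ
  rw [← hβ]
  ext v
  have hsplit : ∀ w, splitMul h α β w = α ![] * β w := fun w => by
    rw [splitMul_apply]
    congr 2
    · exact Subsingleton.elim _ _
    · ext j
      exact congrArg w (Fin.ext (by simp))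
  simp [MultilinearMap.alternatization_apply, hsplit, Finset.mul_sum, mul_smul_comm]

theorem curryLeft_splitMul {n p k : ℕ} (h : p + 1 + k = n + 1) (h' : p + k = n)
    (α : W [⋀^Fin (p + 1)]→ₗ[R] R) (β : W [⋀^Fin k]→ₗ[R] R) (x : W) :
    (splitMul h α β).curryLeft x = splitMul h' (α.curryLeft x) β := by
  subst h'
  ext v
  rw [MultilinearMap.curryLeft_apply, splitMul_apply, splitMul_apply,
    AlternatingMap.curryLeft_apply_apply]
  congr 2
  · ext i
    cases i using Fin.cases <;> rfl
  · ext j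
    have hj : Fin.cast h (Fin.natAdd (p + 1) j) = (Fin.natAdd p j).succ := by
      ext
      simp only [Fin.val_cast, Fin.val_natAdd, Fin.val_succ]
      omega
    rw [hj, Fin.cons_succ]
    rfl

namespace Cochain

/-- Both sides satisfy the same recursion in `p`: alternating over the first argument of the left
side gives the left side back, and on the right side it acts on the factor `α` alone, where it is
multiplication by the degree. -/
theorem ofAlternating_alternatization_splitMul {n p k : ℕ} (h : p + k = n)
    (α : W [⋀^Fin p]→ₗ[R] R) (β : W [⋀^Fin k]→ₗ[R] R) :
    ofAlternating (MultilinearMap.alternatization (splitMul h α β)) =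
      (p.factorial * k.factorial : R) • wedge (ofAlternating α) (ofAlternating β) := by
  induction p generalizing n with
  | zero =>
    obtain rfl : n = k := by omega
    rw [alternatization_splitMul_zero_left,
      wedge_of_contract_eq_zero (contract_ofAlternating_zero α), map_smul, map_smul,
      Nat.factorial_zero, Nat.cast_one, one_mul, ofAlternating_zero_nil, smul_comm]
  | succ p ih =>
    obtain ⟨n, rfl⟩ : ∃ m, n = m + 1 := ⟨p + k, by omega⟩
    have h' : p + k = n := by omega
    rw [alternatization_eq_alternatizeUncurryFin, ofAlternating_alternatizeUncurryFin]
    have hcurry : ∀ x, ofAlternating (alternatizeCurryLeft (splitMul h α β) x) =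
        (p.factorial * k.factorial : R) •
          wedge (contract x (ofAlternating α)) (ofAlternating β) := fun x => by
      rw [contract_ofAlternating_succ, ← ih h', ← curryLeft_splitMul h]
      rfl
    rw [funext hcurry, ← Pi.smul_def, map_smul, alternation_wedge_left,
      alternation_contract_ofAlternating, map_smul, LinearMap.smul_apply, smul_smul]
    push_cast [Nat.factorial_succ]
    ring_nf

end Cochain

end OfAlternating

section WedgeAlt

variable {W : Type*} [AddCommGroup W] [Module ℝ W]

theorem factorial_smul_wedgeAlt {p k : ℕ} (α : W [⋀^Fin p]→ₗ[ℝ] ℝ) (β : W [⋀^Fin k]→ₗ[ℝ] ℝ) :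
    (p.factorial * k.factorial : ℝ) • wedgeAlt α β =
      MultilinearMap.alternatization (splitMul rfl α β) := by
  have hcoprod := MultilinearMap.domCoprod_alternization_eq α β
  rw [Fintype.card_fin, Fintype.card_fin] at hcoprod
  have hsplit : MultilinearMap.alternatization (splitMul rfl α β) =
      (((LinearMap.mul' ℝ ℝ).compAlternatingMap (MultilinearMap.alternatization
        ((α : MultilinearMap ℝ (fun _ => W) ℝ).domCoprod
          (β : MultilinearMap ℝ (fun _ => W) ℝ)))).domDomCongr finSumFinEquiv) := by
    rw [← LinearMap.compMultilinearMap_alternatization, ← alternatization_domDomCongr]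
    rfl
  rw [hsplit, hcoprod, wedgeAlt]
  ext v
  simp

theorem ofAlternating_wedgeAlt {p k : ℕ} (α : W [⋀^Fin p]→ₗ[ℝ] ℝ) (β : W [⋀^Fin k]→ₗ[ℝ] ℝ) :
    Cochain.ofAlternating (wedgeAlt α β) =
      Cochain.wedge (Cochain.ofAlternating α) (Cochain.ofAlternating β) := by
  have hfactorial : (p.factorial * k.factorial : ℝ) ≠ 0 := by positivity
  rw [← (smul_right_injective _ hfactorial).eq_iff]
  rw [← map_smul, factorial_smul_wedgeAlt, Cochain.ofAlternating_alternatization_splitMul]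

theorem ofAlternating_insertAlt (L : W [⋀^Fin 2]→ₗ[ℝ] W) {p : ℕ} (η : W [⋀^Fin p]→ₗ[ℝ] ℝ) :
    Cochain.ofAlternating (insertAlt L η) =
      (1 / 2 : ℝ) • Cochain.pairInsertion (fun a b => L ![a, b]) (Cochain.ofAlternating η) := by
  rw [Cochain.pairInsertion_apply]
  cases p with
  | zero =>
    have hzero : (Cochain.alternation fun _ : W => Cochain.alternation fun _ : W =>
        (0 : Cochain ℝ W)) = 0 := by
      rw [← Pi.zero_def, map_zero, ← Pi.zero_def, map_zero]
    simp only [Cochain.contract_ofAlternating_zero, hzero, smul_zero]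
    exact map_zero _
  | succ p =>
    simp only [insertAlt, map_smul, Cochain.ofAlternating_alternatizeUncurryFin,
      LinearMap.comp_apply, AlternatingMap.alternatizeUncurryFinLM_apply, LinearMap.mk₂_apply,
      Cochain.contract_ofAlternating_succ]

end WedgeAlt

section Shuffles

/-- The images of the first `p` indices under the representative of the `(p, k)`-shuffle `σ`. -/
def shuffleLeft {p k : ℕ} (σ : Equiv.Perm.ModSumCongr (Fin p) (Fin k)) : Fin p → Fin (p + k) :=
  fun i => finSumFinEquiv (σ.out (Sum.inl i))

/-- The images of the last `k` indices under the representative of the `(p, k)`-shuffle `σ`. -/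
def shuffleRight {p k : ℕ} (σ : Equiv.Perm.ModSumCongr (Fin p) (Fin k)) : Fin k → Fin (p + k) :=
  fun i => finSumFinEquiv (σ.out (Sum.inr i))

theorem wedgeAlt_eq_sum_shuffle {W : Type*} [AddCommGroup W] [Module ℝ W] {p k : ℕ}
    (α : W [⋀^Fin p]→ₗ[ℝ] ℝ) (β : W [⋀^Fin k]→ₗ[ℝ] ℝ) (v : Fin (p + k) → W) :
    wedgeAlt α β v = ∑ σ : Equiv.Perm.ModSumCongr (Fin p) (Fin k),
      (Equiv.Perm.sign σ.out : ℝ) * (α (v ∘ shuffleLeft σ) * β (v ∘ shuffleRight σ)) := by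
  simp only [wedgeAlt_apply, zsmul_eq_mul]
  rfl

theorem sum_shuffle {N : Type*} [AddCommMonoid N] {p k : ℕ}
    (σ : Equiv.Perm.ModSumCongr (Fin p) (Fin k)) (g : Fin (p + k) → N) :
    ∑ j, g j = ∑ i, g (shuffleLeft σ i) + ∑ i, g (shuffleRight σ i) := by
  rw [← (σ.out.trans finSumFinEquiv).sum_comp, Fintype.sum_sum_type]
  rfl

theorem shuffleLeft_injective {p k : ℕ} (σ : Equiv.Perm.ModSumCongr (Fin p) (Fin k)) :
    Injective (shuffleLeft σ) :=
  (finSumFinEquiv.injective.comp σ.out.injective).comp Sum.inl_injective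

theorem shuffleRight_injective {p k : ℕ} (σ : Equiv.Perm.ModSumCongr (Fin p) (Fin k)) :
    Injective (shuffleRight σ) :=
  (finSumFinEquiv.injective.comp σ.out.injective).comp Sum.inr_injective

theorem shuffleLeft_ne_shuffleRight {p k : ℕ} (σ : Equiv.Perm.ModSumCongr (Fin p) (Fin k))
    (i : Fin p) (j : Fin k) : shuffleLeft σ i ≠ shuffleRight σ j :=
  (finSumFinEquiv.injective.comp σ.out.injective).ne Sum.inl_ne_inr

theorem sum_wedgeAlt_update {W : Type*} [AddCommGroup W] [Module ℝ W] {p k : ℕ}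
    (α : W [⋀^Fin p]→ₗ[ℝ] ℝ) (β : W [⋀^Fin k]→ₗ[ℝ] ℝ) (v w : Fin (p + k) → W) :
    ∑ j, wedgeAlt α β (update v j (w j)) = ∑ σ : Equiv.Perm.ModSumCongr (Fin p) (Fin k),
      (Equiv.Perm.sign σ.out : ℝ) *
        ((∑ i, α (update (v ∘ shuffleLeft σ) i (w (shuffleLeft σ i)))) * β (v ∘ shuffleRight σ) +
          α (v ∘ shuffleLeft σ) *
            ∑ i, β (update (v ∘ shuffleRight σ) i (w (shuffleRight σ i)))) := by
  simp only [wedgeAlt_eq_sum_shuffle]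
  rw [Finset.sum_comm]
  refine Finset.sum_congr rfl fun σ _ => ?_
  have hleft : ∀ i b, α (update v (shuffleLeft σ i) b ∘ shuffleLeft σ) *
      β (update v (shuffleLeft σ i) b ∘ shuffleRight σ) =
        α (update (v ∘ shuffleLeft σ) i b) * β (v ∘ shuffleRight σ) := fun i b => by
    rw [update_comp_eq_of_injective _ (shuffleLeft_injective σ),
      update_comp_eq_of_forall_ne _ _ fun j => (shuffleLeft_ne_shuffleRight σ i j).symm]
  have hright : ∀ i b, α (update v (shuffleRight σ i) b ∘ shuffleLeft σ) *
      β (update v (shuffleRight σ i) b ∘ shuffleRight σ) =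
        α (v ∘ shuffleLeft σ) * β (update (v ∘ shuffleRight σ) i b) := fun i b => by
    rw [update_comp_eq_of_injective _ (shuffleRight_injective σ),
      update_comp_eq_of_forall_ne _ _ fun j => shuffleLeft_ne_shuffleRight σ j i]
  rw [← Finset.mul_sum, sum_shuffle σ, Finset.sum_mul, Finset.mul_sum]
  simp only [hleft, hright]

end Shuffles

section Mvfderiv

variable {𝕜 : Type*} [NontriviallyNormedField 𝕜] {E : Type*} [NormedAddCommGroup E]
  [NormedSpace 𝕜 E] {H : Type*} [TopologicalSpace H] {I : ModelWithCorners 𝕜 E H}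
  {M : Type*} [TopologicalSpace M] [ChartedSpace H M] {F : Type*} [NormedAddCommGroup F]
  [NormedSpace 𝕜 F]

theorem mvfderiv_sum {ι : Type*} (s : Finset ι) {f : ι → M → F} {x : M}
    (hf : ∀ i ∈ s, MDifferentiableAt I 𝓘(𝕜, F) (f i) x) :
    mvfderiv I (∑ i ∈ s, f i) x = ∑ i ∈ s, mvfderiv I (f i) x := by
  suffices MDifferentiableAt I 𝓘(𝕜, F) (∑ i ∈ s, f i) x ∧
      mvfderiv I (∑ i ∈ s, f i) x = ∑ i ∈ s, mvfderiv I (f i) x from this.2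
  induction s using Finset.cons_induction with
  | empty =>
    simp only [Finset.sum_empty]
    exact ⟨mdifferentiableAt_const, mvfderiv_zero⟩
  | cons i s hi ih =>
    rw [Finset.forall_mem_cons] at hf
    obtain ⟨hs, hsum⟩ := ih hf.2
    simp only [Finset.sum_cons]
    exact ⟨hf.1.add hs, by rw [mvfderiv_add hf.1 hs, hsum]⟩

theorem mvfderiv_const_smul (c : 𝕜) {f : M → F} {x : M}
    (hf : MDifferentiableAt I 𝓘(𝕜, F) f x) : mvfderiv I (c • f) x = c • mvfderiv I f x := by
  change mvfderiv I (fun y => c • f y) x = _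
  rw [mvfderiv_fun_smul mdifferentiableAt_const hf, mvfderiv_const]
  simp

end Mvfderiv

variable {E : Type*} [NormedAddCommGroup E] [NormedSpace ℝ E]
  {H : Type*} [TopologicalSpace H] {I : ModelWithCorners ℝ E H}
  {M : Type*} [TopologicalSpace M] [ChartedSpace H M]
  {F : Type*} [NormedAddCommGroup F] [NormedSpace ℝ F]
  {V : M → Type*} [TopologicalSpace (TotalSpace F V)]
  [∀ x, AddCommGroup (V x)] [∀ x, Module ℝ (V x)] [∀ x, TopologicalSpace (V x)]
  [FiberBundle F V]

section Forms

/-- The value of a form at the point `x`, as a cochain on the fibre. -/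
def cochainAt {p : ℕ} (x : M) : EForm I F V p →ₗ[ℝ] Cochain ℝ (V x) :=
  Cochain.ofAlternating ∘ₗ LinearMap.proj x ∘ₗ (EForm I F V p).subtype

theorem cochainAt_eq {p : ℕ} (x : M) (η : EForm I F V p) :
    cochainAt x η = Cochain.ofAlternating (η.1 x) :=
  rfl

theorem eq_of_cochainAt_eq {p : ℕ} {η η' : EForm I F V p}
    (h : ∀ x, cochainAt x η = cochainAt x η') : η = η' :=
  Subtype.ext (funext fun x => Cochain.ofAlternating_injective (h x))

theorem cochainAt_castDeg {p k : ℕ} (h : p = k) (η : EForm I F V p) (x : M) :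
    cochainAt x (castDeg h η) = cochainAt x η :=
  Cochain.ofAlternating_domDomCongr_finCongr h (η.1 x)

theorem cochainAt_wedge {p k : ℕ} (α : EForm I F V p) (β : EForm I F V k) (x : M) :
    cochainAt x (wedge α β) = Cochain.wedge (cochainAt x α) (cochainAt x β) :=
  ofAlternating_wedgeAlt (α.1 x) (β.1 x)

theorem parity_cochainAt {p : ℕ} (η : EForm I F V p) (x : M) :
    Cochain.parity (cochainAt x η) = (-1 : ℝ) ^ p • cochainAt x η :=
  Cochain.parity_ofAlternating (η.1 x)

theorem wedge_cochainAt_ofFunction (f : C^∞⟮I, M; ℝ⟯) (x : M) (φ : Cochain ℝ (V x)) :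
    Cochain.wedge (cochainAt x (ofFunction f : EForm I F V 0)) φ = f x • φ := by
  rw [cochainAt_eq, Cochain.wedge_of_contract_eq_zero (Cochain.contract_ofAlternating_zero _),
    Cochain.ofAlternating_zero_nil]
  rfl

theorem eq_wedge_add_wedge_iff {p k : ℕ} {ζ : EForm I F V (p + k + 1)} {α : EForm I F V p}
    {α' : EForm I F V (p + 1)} {β : EForm I F V k} {β' : EForm I F V (k + 1)} :
    ζ = castDeg (Nat.add_right_comm p 1 k) (wedge α' β) + (-1 : ℝ) ^ p • wedge α β' ↔
      ∀ x, cochainAt x ζ = Cochain.wedge (cochainAt x α') (cochainAt x β) +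
        Cochain.wedge (Cochain.parity (cochainAt x α)) (cochainAt x β') := by
  have hright : ∀ x, cochainAt x (castDeg (Nat.add_right_comm p 1 k) (wedge α' β) +
      (-1 : ℝ) ^ p • (wedge α β' : EForm I F V (p + (k + 1))) : EForm I F V (p + k + 1)) =
      Cochain.wedge (cochainAt x α') (cochainAt x β) +
        Cochain.wedge (Cochain.parity (cochainAt x α)) (cochainAt x β') := fun x => by
    have hwedge : cochainAt (p := p + k + 1) x (wedge α β' : EForm I F V (p + (k + 1))) =
        Cochain.wedge (cochainAt x α) (cochainAt x β') := cochainAt_wedge α β' x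
    rw [map_add, map_smul, cochainAt_castDeg, cochainAt_wedge, hwedge, parity_cochainAt, map_smul,
      LinearMap.smul_apply]
  simp only [← hright]
  exact ⟨fun h x => congrArg (cochainAt x) h, eq_of_cochainAt_eq⟩

namespace DerivationOne

theorem cochainAt_wedge (D : DerivationOne I F V) {p k : ℕ} (α : EForm I F V p)
    (β : EForm I F V k) (x : M) :
    cochainAt x (D.toFun (p + k) (wedge α β)) =
      Cochain.wedge (cochainAt x (D.toFun p α)) (cochainAt x β) +
        Cochain.wedge (Cochain.parity (cochainAt x α)) (cochainAt x (D.toFun k β)) :=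
  eq_wedge_add_wedge_iff.1 (D.leibniz p k α β) x

theorem cochainAt_castDeg (D : DerivationOne I F V) {p k : ℕ} (h : p = k) (η : EForm I F V p)
    (x : M) : cochainAt x (D.toFun k (castDeg h η)) = cochainAt x (D.toFun p η) := by
  subst h
  rfl

theorem ext {D D' : DerivationOne I F V} (h : ∀ p η, D.toFun p η = D'.toFun p η) : D = D' := by
  cases D
  cases D'
  congr
  ext p η : 2
  exact h p η

instance : Add (DerivationOne I F V) where
  add D D' :=
    { toFun := fun p => D.toFun p + D'.toFun p
      leibniz := fun p k α β => eq_wedge_add_wedge_iff.2 fun x => by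
        simp only [LinearMap.add_apply, map_add, cochainAt_wedge]
        abel }

end DerivationOne

/-- The interior product of a smooth section with a form. -/
def contract {p : ℕ} (A : Cₛ^∞⟮I; F, V⟯) (η : EForm I F V (p + 1)) : EForm I F V p :=
  ⟨fun x => (η.1 x).curryLeft (A x), fun B => by
    convert (evalForm η (Matrix.vecCons A B)).contMDiff using 2 with x
    refine congrArg (η.1 x) ?_
    ext k
    cases k using Fin.cases <;> rfl⟩

theorem cochainAt_contract {p : ℕ} (A : Cₛ^∞⟮I; F, V⟯) (η : EForm I F V (p + 1)) (x : M) :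
    cochainAt x (contract A η) = Cochain.contract (A x) (cochainAt x η) :=
  (Cochain.contract_ofAlternating_succ (η.1 x) (A x)).symm

theorem eq_ofFunction (η : EForm I F V 0) : η = ofFunction (evalForm η ![]) := by
  refine Subtype.ext (funext fun x => ?_)
  ext v
  exact congrArg (η.1 x) (Subsingleton.elim _ _)

theorem sum_wedge_contract {ι : Type*} [Fintype ι] {e : ι → Cₛ^∞⟮I; F, V⟯}
    {θ : ι → EForm I F V 1} {ρ : C^∞⟮I, M; ℝ⟯}
    (h : ∀ y (b : V y), ∑ k, (θ k).1 y ![b] • e k y = ρ y • b) {p : ℕ} (η : EForm I F V (p + 1)) :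
    ∑ k, castDeg (add_comm 1 p) (wedge (θ k) (contract (e k) η)) =
      ((p : ℝ) + 1) • castDeg (zero_add (p + 1)) (wedge (ofFunction ρ) η) := by
  refine eq_of_cochainAt_eq fun x => ?_
  simp only [map_sum, map_smul, cochainAt_castDeg, cochainAt_wedge, cochainAt_contract,
    wedge_cochainAt_ofFunction]
  exact Cochain.sum_wedge_contract_ofAlternating (h x) (η.1 x)

end Forms

section Frames

/-- The value of a smooth section at the point `x`. -/
def sectionAt [VectorBundle ℝ F V] (x : M) : Cₛ^∞⟮I; F, V⟯ →ₗ[ℝ] V x where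
  toFun A := A x
  map_add' _ _ := rfl
  map_smul' _ _ := rfl

theorem sectionAt_apply [VectorBundle ℝ F V] (x : M) (A : Cₛ^∞⟮I; F, V⟯) : sectionAt x A = A x :=
  rfl

theorem fmul_eq_sum_evalForm_fmul [VectorBundle ℝ F V] {ι : Type*} [Fintype ι]
    {e : ι → Cₛ^∞⟮I; F, V⟯} {θ : ι → EForm I F V 1} {ρ : C^∞⟮I, M; ℝ⟯}
    (h : ∀ y (b : V y), ∑ k, (θ k).1 y ![b] • e k y = ρ y • b) (A : Cₛ^∞⟮I; F, V⟯) :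
    fmul ρ A = ∑ k, fmul (evalForm (θ k) ![A]) (e k) := by
  ext y
  rw [← sectionAt_apply, ← sectionAt_apply, map_sum]
  refine (h y (A y)).symm.trans (Finset.sum_congr rfl fun k _ => ?_)
  refine congrArg (fun v => (θ k).1 y v • e k y) ?_
  ext i
  rw [Subsingleton.elim i 0]
  rfl

variable [VectorBundle ℝ F V] [IsManifold I ∞ M] [ContMDiffVectorBundle ∞ F V I]
  [FiniteDimensional ℝ E] [FiniteDimensional ℝ F] [T2Space M]

variable (I F V) in
/-- The `e k` and `θ k` are a local frame and its dual frame, both multiplied by a bump function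
whose square is `ρ`. -/
theorem exists_frame (x : M) : ∃ (r : ℕ) (e : Fin r → Cₛ^∞⟮I; F, V⟯) (θ : Fin r → EForm I F V 1)
    (ρ : C^∞⟮I, M; ℝ⟯), ρ x = 1 ∧ ∀ y (b : V y), ∑ k, (θ k).1 y ![b] • e k y = ρ y • b := by
  have : ContMDiffVectorBundle 1 F V I := ContMDiffVectorBundle.of_le (n := ∞) (by simp)
  let t := trivializationAt F V x
  let b := Module.finBasis ℝ F
  obtain ⟨f, -, hf⟩ := (SmoothBumpFunction.nhds_basis_tsupport (I := I) x).mem_iff.1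
    (t.open_baseSet.mem_nhds (FiberBundle.mem_baseSet_trivializationAt' x))
  let e : Fin (Module.finrank ℝ F) → Cₛ^∞⟮I; F, V⟯ := fun k => ⟨(f : M → ℝ) • t.localFrame b k,
    ContMDiffOn.smul_section_of_tsupport f.contMDiff.contMDiffOn t.open_baseSet hf
      (t.contMDiffOn_localFrame_baseSet (I := I) ∞ b k)⟩
  have hθ : ∀ k (A : Fin 1 → Cₛ^∞⟮I; F, V⟯),
      ContMDiff I 𝓘(ℝ, ℝ) ∞ fun y => f y * t.localFrameCoeff I b k y (A 0 y) := fun k A => by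
    refine contMDiff_of_tsupport fun y hy => ?_
    exact f.contMDiffAt.mul (contMDiffAt_localFrameCoeff b (hf (tsupport_mul_subset_left hy))
      (A 0).contMDiff.contMDiffAt k)
  let θ : Fin (Module.finrank ℝ F) → EForm I F V 1 := fun k =>
    ⟨fun y => AlternatingMap.ofSubsingleton ℝ (V y) ℝ (0 : Fin 1)
      (f y • t.localFrameCoeff I b k y), hθ k⟩
  refine ⟨_, e, θ, ⟨fun y => f y * f y, f.contMDiff.mul f.contMDiff⟩, by simp, fun y v => ?_⟩
  by_cases hy : y ∈ t.baseSet
  · have hv := t.eq_sum_localFrameCoeff_smul (I := I) (b := b) hy (s := FiberBundle.extend F v)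
    rw [FiberBundle.extend_apply_self] at hv
    conv_rhs => rw [hv, Finset.smul_sum]
    refine Finset.sum_congr rfl fun k _ => ?_
    change (f y * t.localFrameCoeff I b k y v) • f y • t.localFrame b k y =
      (f y * f y) • t.localFrameCoeff I b k y v • t.localFrame b k y
    simp only [smul_smul, mul_right_comm]
  · have hfy : f y = 0 := image_eq_zero_of_notMem_tsupport fun h => hy (hf h)
    simp [e, hfy]

theorem exists_section_apply_eq (x : M) (b : V x) : ∃ A : Cₛ^∞⟮I; F, V⟯, A x = b := by
  obtain ⟨r, e, θ, ρ, hρ, he⟩ := exists_frame I F V x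
  refine ⟨∑ k, (θ k).1 x ![b] • e k, ?_⟩
  rw [← sectionAt_apply, map_sum]
  exact (he x b).trans (by rw [hρ, one_smul])

theorem exists_sections_apply_eq {ι : Type*} (x : M) (b : ι → V x) :
    ∃ A : ι → Cₛ^∞⟮I; F, V⟯, (fun i => A i x) = b := by
  choose A hA using fun i => exists_section_apply_eq (I := I) (F := F) x (b i)
  exact ⟨A, funext hA⟩

theorem eq_of_evalForm_eq {p : ℕ} {η η' : EForm I F V p}
    (h : ∀ A x, evalForm η A x = evalForm η' A x) : η = η' := by
  refine Subtype.ext (funext fun x => ?_)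
  ext b
  obtain ⟨A, rfl⟩ := exists_sections_apply_eq (I := I) (F := F) x b
  exact h A x

theorem apply_eq_of_apply_eq {T : Cₛ^∞⟮I; F, V⟯ →ₗ[ℝ] Cₛ^∞⟮I; F, V⟯}
    (hT : ∀ (f : C^∞⟮I, M; ℝ⟯) A, T (fmul f A) = fmul f (T A)) {A A' : Cₛ^∞⟮I; F, V⟯} {x : M}
    (h : A x = A' x) : T A x = T A' x := by
  obtain ⟨r, e, θ, ρ, hρ, he⟩ := exists_frame I F V x
  have hsum : ∀ B, T B x = ∑ k, evalForm (θ k) ![B] x • T (e k) x := fun B =>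
    calc T B x = ρ x • T B x := by rw [hρ, one_smul]
      _ = sectionAt x (T (fmul ρ B)) := by rw [hT]; rfl
      _ = ∑ k, sectionAt x (fmul (evalForm (θ k) ![B]) (T (e k))) := by
        simp only [fmul_eq_sum_evalForm_fmul he B, map_sum, hT]
  have hθ : ∀ k, evalForm (θ k) ![A] x = evalForm (θ k) ![A'] x := fun k => by
    refine congrArg ((θ k).1 x) (funext fun i => ?_)
    rw [Subsingleton.elim i 0]
    exact h
  rw [hsum A, hsum A']
  simp only [hθ]

end Frames

namespace DerivationOne

variable [VectorBundle ℝ F V] [IsManifold I ∞ M] [ContMDiffVectorBundle ∞ F V I]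
  [FiniteDimensional ℝ E] [FiniteDimensional ℝ F] [T2Space M]

/-- With `∑ₖ θₖ(b) eₖ = ρ b`, the form `ρ η` of positive degree is up to a factor
`∑ₖ θₖ ∧ ι_{eₖ} η`, whose factors have smaller degree unless they have degree `1`. -/
theorem ext_of_degree_le_one {D D' : DerivationOne I F V}
    (h0 : ∀ f : C^∞⟮I, M; ℝ⟯, D.toFun 0 (ofFunction f) = D'.toFun 0 (ofFunction f))
    (h1 : ∀ α, D.toFun 1 α = D'.toFun 1 α) : D = D' := by
  refine ext fun p => ?_
  induction p with
  | zero =>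
    intro η
    rw [eq_ofFunction η, h0]
  | succ p ih =>
    refine fun η => eq_of_cochainAt_eq fun x => ?_
    obtain ⟨r, e, θ, ρ, hρ, he⟩ := exists_frame I F V x
    have hη := sum_wedge_contract he η
    have hD := congrArg (fun ζ => cochainAt x (D.toFun (p + 1) ζ)) hη
    have hD' := congrArg (fun ζ => cochainAt x (D'.toFun (p + 1) ζ)) hη
    simp only [map_sum, map_smul, cochainAt_castDeg, cochainAt_wedge, h0, h1, ih] at hD hD'
    have hdegree : (p : ℝ) + 1 ≠ 0 := by positivity
    have hρη := add_left_cancel (smul_right_injective _ hdegree (hD.symm.trans hD'))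
    simpa only [parity_cochainAt, pow_zero, one_smul, wedge_cochainAt_ofFunction, hρ] using hρη

end DerivationOne

section Tensoriality

variable [VectorBundle ℝ F V] [IsManifold I ∞ M] [ContMDiffVectorBundle ∞ F V I]
  [FiniteDimensional ℝ E] [FiniteDimensional ℝ F] [T2Space M]

theorem multilinear_apply_eq_of_apply_eq {ι : Type*} [Finite ι] [DecidableEq ι]
    {T : MultilinearMap ℝ (fun _ : ι => Cₛ^∞⟮I; F, V⟯) Cₛ^∞⟮I; F, V⟯}
    (hT : ∀ A i (f : C^∞⟮I, M; ℝ⟯) B, T (update A i (fmul f B)) = fmul f (T (update A i B)))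
    {A A' : ι → Cₛ^∞⟮I; F, V⟯} {x : M} (h : ∀ i, A i x = A' i x) : T A x = T A' x := by
  cases nonempty_fintype ι
  have hpiecewise : ∀ s : Finset ι, T (s.piecewise A' A) x = T A x := fun s => by
    induction s using Finset.induction_on with
    | empty => rw [Finset.piecewise_empty]
    | insert i s hi ih =>
      have hupdate : update (s.piecewise A' A) i (A i) = s.piecewise A' A := by
        rw [update_eq_self_iff, Finset.piecewise_eq_of_notMem _ _ _ hi]
      rw [Finset.piecewise_insert, ← ih]
      conv_rhs => rw [← hupdate]
      exact apply_eq_of_apply_eq (T := T.toLinearMap (s.piecewise A' A) i) (hT _ i) (h i).symm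
  rw [← hpiecewise Finset.univ, Finset.piecewise_univ]

theorem EValuedForm.exists_eval_eq {k : ℕ} {T : Cₛ^∞⟮I; F, V⟯ [⋀^Fin k]→ₗ[ℝ] Cₛ^∞⟮I; F, V⟯}
    (hT : ∀ A i (f : C^∞⟮I, M; ℝ⟯) B, T (update A i (fmul f B)) = fmul f (T (update A i B))) :
    ∃ L : EValuedForm I F V k, ∀ A, L.eval A = T A := by
  choose s hs using fun x (b : V x) => exists_section_apply_eq (I := I) (F := F) x b
  have hvalue : ∀ x (v : Fin k → V x) (A : Fin k → Cₛ^∞⟮I; F, V⟯), (∀ i, A i x = v i) →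
      T (fun i => s x (v i)) x = T A x := fun x v A hA =>
    multilinear_apply_eq_of_apply_eq (T := T.toMultilinearMap) hT fun i =>
      (hs x _).trans (hA i).symm
  have hupdate : ∀ x (v : Fin k → V x) i (B : Cₛ^∞⟮I; F, V⟯),
      T (fun j => s x (update v i (B x) j)) x = T (update (fun j => s x (v j)) i B) x :=
    fun x v i B => hvalue x _ _ fun j => by
      obtain rfl | hj := eq_or_ne j i
      · simp
      · simp [hj, hs]
  let L : ∀ x, V x [⋀^Fin k]→ₗ[ℝ] V x := fun x =>
    { toFun := fun v => T (fun i => s x (v i)) x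
      map_update_add' := fun {inst} v i b b' => by
        have hadd : (s x b + s x b') x = b + b' := congrArg₂ (· + ·) (hs x b) (hs x b')
        rw [Subsingleton.elim inst (instDecidableEqFin k), ← hadd, hupdate, T.map_update_add]
        conv_rhs => rw [← hs x b, ← hs x b']
        rw [hupdate, hupdate]
        rfl
      map_update_smul' := fun {inst} v i c b => by
        have hsmul : (c • s x b) x = c • b := congrArg (c • ·) (hs x b)
        rw [Subsingleton.elim inst (instDecidableEqFin k), ← hsmul, hupdate, T.map_update_smul]
        conv_rhs => rw [← hs x b, hupdate]
        rfl
      map_eq_zero_of_eq' := fun v i j h hij => by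
        rw [T.map_eq_zero_of_eq _ (congrArg (s x) h) hij]
        rfl }
  have hL : ∀ (A : Fin k → Cₛ^∞⟮I; F, V⟯) x, L x (fun i => A i x) = T A x := fun A x =>
    hvalue x _ A fun _ => rfl
  exact ⟨⟨L, fun A => by simpa only [hL] using (T A).contMDiff⟩, fun A =>
    ContMDiffSection.ext fun x => hL A x⟩

end Tensoriality

section Torsion

/-- An alternating bilinear map, as a map in `Fin 2` variables. -/
def alternatingOfIsAlt {R W N : Type*} [CommRing R] [AddCommGroup W] [Module R W] [AddCommGroup N]
    [Module R N] {B : W →ₗ[R] W →ₗ[R] N} (hB : B.IsAlt) : W [⋀^Fin 2]→ₗ[R] N where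
  toFun v := B (v 0) (v 1)
  map_update_add' v i x y := by fin_cases i <;> simp
  map_update_smul' v i c x := by fin_cases i <;> simp
  map_eq_zero_of_eq' v i j h hij := by
    have h01 : v 0 = v 1 := by fin_cases i <;> fin_cases j <;> simp_all
    rw [h01]
    exact hB (v 1)

theorem alternatingOfIsAlt_apply {R W N : Type*} [CommRing R] [AddCommGroup W] [Module R W]
    [AddCommGroup N] [Module R N] {B : W →ₗ[R] W →ₗ[R] N} (hB : B.IsAlt) (v : Fin 2 → W) :
    alternatingOfIsAlt hB v = B (v 0) (v 1) :=
  rfl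

variable [VectorBundle ℝ F V] [IsManifold I ∞ M] {𝔞 : LieAlgebroid I F V}

namespace EConnection

/-- The torsion as an `ℝ`-bilinear map on sections. -/
def torsionBilin (δ : EConnection 𝔞) : Cₛ^∞⟮I; F, V⟯ →ₗ[ℝ] Cₛ^∞⟮I; F, V⟯ →ₗ[ℝ] Cₛ^∞⟮I; F, V⟯ :=
  δ.toFun - δ.toFun.flip - 𝔞.bracket

theorem torsionBilin_apply (δ : EConnection 𝔞) (A B : Cₛ^∞⟮I; F, V⟯) :
    δ.torsionBilin A B = δ.torsion A B :=
  rfl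

theorem isAlt_torsionBilin (δ : EConnection 𝔞) : δ.torsionBilin.IsAlt := fun A => by
  rw [torsionBilin_apply, torsion, 𝔞.bracket_self, sub_self, sub_zero]

theorem torsionBilin_fmul_right (δ : EConnection 𝔞) (A B : Cₛ^∞⟮I; F, V⟯) (f : C^∞⟮I, M; ℝ⟯) :
    δ.torsionBilin A (fmul f B) = fmul f (δ.torsionBilin A B) := by
  ext x
  change δ.toFun A (fmul f B) x - δ.toFun (fmul f B) A x - 𝔞.bracket A (fmul f B) x =
    f x • (δ.toFun A B x - δ.toFun B A x - 𝔞.bracket A B x)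
  have hleft : δ.toFun (fmul f B) A x = f x • δ.toFun B A x :=
    congrArg (· x) (δ.fmul_left f B A)
  rw [δ.leibniz, 𝔞.leibniz, hleft]
  module

theorem torsionBilin_fmul_left (δ : EConnection 𝔞) (A B : Cₛ^∞⟮I; F, V⟯) (f : C^∞⟮I, M; ℝ⟯) :
    δ.torsionBilin (fmul f A) B = fmul f (δ.torsionBilin A B) := by
  rw [← δ.isAlt_torsionBilin.neg, torsionBilin_fmul_right, ← δ.isAlt_torsionBilin.neg A B]
  ext x
  change -(f x • -δ.torsionBilin A B x) = f x • δ.torsionBilin A B x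
  rw [smul_neg, neg_neg]

theorem exists_torsion_tensor [ContMDiffVectorBundle ∞ F V I] [FiniteDimensional ℝ E]
    [FiniteDimensional ℝ F] [T2Space M] (δ : EConnection 𝔞) :
    ∃ L : EValuedForm I F V 2, ∀ A B : Cₛ^∞⟮I; F, V⟯, L.eval ![A, B] = δ.torsion A B := by
  obtain ⟨L, hL⟩ := EValuedForm.exists_eval_eq (T := alternatingOfIsAlt δ.isAlt_torsionBilin)
    fun A i f B => by
      simp only [alternatingOfIsAlt_apply]
      fin_cases i
      · simp [torsionBilin_fmul_left]
      · simp [torsionBilin_fmul_right]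
  exact ⟨L, fun A B => hL ![A, B]⟩

end EConnection

end Torsion

section CovForm

theorem mdifferentiableAt_evalForm {p : ℕ} (η : EForm I F V p) (B : Fin p → Cₛ^∞⟮I; F, V⟯)
    (x : M) : MDifferentiableAt I 𝓘(ℝ, ℝ) (evalForm η B) x :=
  (evalForm η B).contMDiff.mdifferentiableAt (by simp)

theorem mvfderiv_evalForm_wedge {p k : ℕ} (α : EForm I F V p) (β : EForm I F V k) (x : M)
    (B : Fin (p + k) → Cₛ^∞⟮I; F, V⟯) :
    mvfderiv I (evalForm (wedge α β) B) x = ∑ σ : Equiv.Perm.ModSumCongr (Fin p) (Fin k),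
      (Equiv.Perm.sign σ.out : ℝ) •
        (evalForm α (B ∘ shuffleLeft σ) x • mvfderiv I (evalForm β (B ∘ shuffleRight σ)) x +
          evalForm β (B ∘ shuffleRight σ) x • mvfderiv I (evalForm α (B ∘ shuffleLeft σ)) x) := by
  have heval : ⇑(evalForm (wedge α β) B) = ∑ σ : Equiv.Perm.ModSumCongr (Fin p) (Fin k),
      (Equiv.Perm.sign σ.out : ℝ) •
        (⇑(evalForm α (B ∘ shuffleLeft σ)) * ⇑(evalForm β (B ∘ shuffleRight σ))) := by
    ext y
    rw [Finset.sum_apply]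
    exact wedgeAlt_eq_sum_shuffle (α.1 y) (β.1 y) fun i => B i y
  have hmul : ∀ σ : Equiv.Perm.ModSumCongr (Fin p) (Fin k), MDifferentiableAt I 𝓘(ℝ, ℝ)
      (⇑(evalForm α (B ∘ shuffleLeft σ)) * ⇑(evalForm β (B ∘ shuffleRight σ))) x := fun σ =>
    (mdifferentiableAt_evalForm α _ x).mul (mdifferentiableAt_evalForm β _ x)
  rw [heval, mvfderiv_sum _ fun σ _ => (hmul σ).const_smul _]
  refine Finset.sum_congr rfl fun σ _ => ?_
  rw [mvfderiv_const_smul _ (hmul σ), mvfderiv_mul (mdifferentiableAt_evalForm α _ x)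
    (mdifferentiableAt_evalForm β _ x)]

variable [VectorBundle ℝ F V] [IsManifold I ∞ M]
  [∀ x, IsTopologicalAddGroup (V x)] [∀ x, ContinuousSMul ℝ (V x)]
  [ContMDiffVectorBundle ∞ F V I] [FiniteDimensional ℝ E] [FiniteDimensional ℝ F] [T2Space M]

theorem covForm_apply_section (cov : CovariantDerivative I F V) {p : ℕ} (η : EForm I F V p) (x : M)
    (v : TangentSpace I x) (B : Fin p → Cₛ^∞⟮I; F, V⟯) :
    covForm cov η x v (fun i => B i x) = mvfderiv I (evalForm η B) x v -
      ∑ j, η.1 x (update (fun i => B i x) j (cov (B j) x v)) :=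
  covForm_apply cov η x v B

theorem covForm_wedge (cov : CovariantDerivative I F V) {p k : ℕ} (α : EForm I F V p)
    (β : EForm I F V k) (x : M) (v : TangentSpace I x) :
    covForm cov (wedge α β) x v =
      wedgeAlt (covForm cov α x v) (β.1 x) + wedgeAlt (α.1 x) (covForm cov β x v) := by
  ext b
  obtain ⟨B, rfl⟩ := exists_sections_apply_eq (I := I) (F := F) x b
  have hsum := sum_wedgeAlt_update (α.1 x) (β.1 x) (fun i => B i x) fun i => cov (B i) x v
  rw [covForm_apply_section, mvfderiv_evalForm_wedge, AlternatingMap.add_apply,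
    wedgeAlt_eq_sum_shuffle, wedgeAlt_eq_sum_shuffle, ← Finset.sum_add_distrib]
  refine (congrArg (_ - ·) hsum).trans ?_
  rw [sum_apply, ← Finset.sum_sub_distrib]
  refine Finset.sum_congr rfl fun σ _ => ?_
  have hα := covForm_apply_section cov α x v (B ∘ shuffleLeft σ)
  have hβ := covForm_apply_section cov β x v (B ∘ shuffleRight σ)
  simp only [comp_def] at hα hβ ⊢
  rw [hα, hβ]
  simp only [smul_apply, add_apply, smul_eq_mul]
  change _ * (α.1 x _ * _ + β.1 x _ * _) - _ = _
  ring

theorem covForm_add (cov : CovariantDerivative I F V) {p : ℕ} (η η' : EForm I F V p) (x : M) :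
    covForm cov (η + η') x = covForm cov η x + covForm cov η' x := by
  ext v b
  obtain ⟨B, rfl⟩ := exists_sections_apply_eq (I := I) (F := F) x b
  have hderiv : mvfderiv I (evalForm (η + η') B) x =
      mvfderiv I (evalForm η B) x + mvfderiv I (evalForm η' B) x :=
    mvfderiv_add (mdifferentiableAt_evalForm η B x) (mdifferentiableAt_evalForm η' B x)
  have hsum : ∑ j, (η + η').1 x (update (fun i => B i x) j (cov (B j) x v)) = _ :=
    Finset.sum_add_distrib
  rw [LinearMap.add_apply, AlternatingMap.add_apply, covForm_apply_section, covForm_apply_section,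
    covForm_apply_section, hderiv, hsum, add_apply]
  exact add_sub_add_comm _ _ _ _

theorem covForm_smul (cov : CovariantDerivative I F V) {p : ℕ} (c : ℝ) (η : EForm I F V p)
    (x : M) : covForm cov (c • η) x = c • covForm cov η x := by
  ext v b
  obtain ⟨B, rfl⟩ := exists_sections_apply_eq (I := I) (F := F) x b
  have hderiv : mvfderiv I (evalForm (c • η) B) x = c • mvfderiv I (evalForm η B) x :=
    mvfderiv_const_smul c (mdifferentiableAt_evalForm η B x)
  have hsum : ∑ j, (c • η).1 x (update (fun i => B i x) j (cov (B j) x v)) = _ :=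
    (Finset.mul_sum _ _ c).symm
  rw [LinearMap.smul_apply, AlternatingMap.smul_apply, covForm_apply_section,
    covForm_apply_section, hderiv, hsum, smul_apply]
  exact (mul_sub _ _ _).symm

end CovForm

section Derivations

section Nabla

variable [VectorBundle ℝ F V] [IsManifold I ∞ M]
  [∀ x, IsTopologicalAddGroup (V x)] [∀ x, ContinuousSMul ℝ (V x)]
  [ContMDiffVectorBundle ∞ F V I] [FiniteDimensional ℝ E] [FiniteDimensional ℝ F] [T2Space M]
  (cov : CovariantDerivative I F V) [cov.ContMDiffCovariantDerivative ∞]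
  (q : BundleMapToTangent I F V)

theorem cochainAt_nablaForm {p : ℕ} (η : EForm I F V p) (x : M) :
    cochainAt x (nablaForm cov q η) =
      Cochain.alternation fun y => Cochain.ofAlternating (covForm cov η x (q.toFun x y)) :=
  Cochain.ofAlternating_alternatizeUncurryFin (covForm cov η x ∘ₗ (q.toFun x).toLinearMap)

theorem nablaForm_add {p : ℕ} (η η' : EForm I F V p) :
    nablaForm cov q (η + η') = nablaForm cov q η + nablaForm cov q η' := by
  refine Subtype.ext (funext fun x => ?_)
  change AlternatingMap.alternatizeUncurryFin _ = AlternatingMap.alternatizeUncurryFin _ + _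
  rw [covForm_add, LinearMap.add_comp]
  exact AlternatingMap.alternatizeUncurryFin_add _ _

theorem nablaForm_smul {p : ℕ} (c : ℝ) (η : EForm I F V p) :
    nablaForm cov q (c • η) = c • nablaForm cov q η := by
  refine Subtype.ext (funext fun x => ?_)
  change AlternatingMap.alternatizeUncurryFin _ =
    c • AlternatingMap.alternatizeUncurryFin (covForm cov η x ∘ₗ (q.toFun x).toLinearMap)
  rw [covForm_smul, LinearMap.smul_comp, AlternatingMap.alternatizeUncurryFin_smul]

/-- The operator `∇_q` as a derivation. -/
def nablaDerivation : DerivationOne I F V where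
  toFun p :=
    { toFun := nablaForm cov q
      map_add' := nablaForm_add cov q
      map_smul' := nablaForm_smul cov q }
  leibniz p k α β := eq_wedge_add_wedge_iff.2 fun x => by
    simp only [LinearMap.coe_mk, AddHom.coe_mk, cochainAt_nablaForm, covForm_wedge, map_add,
      ofAlternating_wedgeAlt]
    rw [← Cochain.alternation_wedge_left, ← Cochain.alternation_wedge_right, ← map_add]
    rfl

end Nabla

section Insertion

variable (L : EValuedForm I F V 2)

theorem cochainAt_insertion {p : ℕ} (η : EForm I F V p) (x : M) :
    cochainAt x (insertion L η) =
      (1 / 2 : ℝ) • Cochain.pairInsertion (fun a b => L.toFun x ![a, b]) (cochainAt x η) := by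
  cases p <;> exact ofAlternating_insertAlt (L.toFun x) (η.1 x)

theorem insertion_add {p : ℕ} (η η' : EForm I F V p) :
    insertion L (η + η') = insertion L η + insertion L η' :=
  eq_of_cochainAt_eq fun x => by simp only [map_add, cochainAt_insertion, smul_add]

theorem insertion_smul {p : ℕ} (c : ℝ) (η : EForm I F V p) :
    insertion L (c • η) = c • insertion L η :=
  eq_of_cochainAt_eq fun x => by simp only [map_smul, cochainAt_insertion, smul_comm c]

/-- The insertion `ι_L` as a derivation. -/
def insertionDerivation : DerivationOne I F V where
  toFun p :=
    { toFun := insertion L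
      map_add' := insertion_add L
      map_smul' := insertion_smul L }
  leibniz p k α β := eq_wedge_add_wedge_iff.2 fun x => by
    simp only [LinearMap.coe_mk, AddHom.coe_mk, cochainAt_insertion, cochainAt_wedge,
      Cochain.pairInsertion_wedge, map_smul, smul_add, LinearMap.smul_apply]

end Insertion

end Derivations

section Differential

theorem evalForm_one_sub [VectorBundle ℝ F V] (α : EForm I F V 1) (A B : Cₛ^∞⟮I; F, V⟯)
    (x : M) : evalForm α ![A - B] x = evalForm α ![A] x - evalForm α ![B] x := by
  have hvec : ∀ C : Cₛ^∞⟮I; F, V⟯, (fun i => ![C] i x) = ![C x] := fun C => by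
    ext i
    rw [Subsingleton.elim i 0]
    rfl
  change α.1 x (fun i => ![A - B] i x) = α.1 x (fun i => ![A] i x) - α.1 x fun i => ![B] i x
  rw [hvec, hvec, hvec]
  exact congrArg (· ![]) (map_sub ((α.1 x).curryLeft) (A x) (B x))

theorem evalForm_insertion_zero (L : EValuedForm I F V 2) (η : EForm I F V 0)
    (A : Fin 1 → Cₛ^∞⟮I; F, V⟯) (x : M) : evalForm (insertion L η) A x = 0 :=
  rfl

theorem evalForm_insertion_one (L : EValuedForm I F V 2) (α : EForm I F V 1)
    (A B : Cₛ^∞⟮I; F, V⟯) (x : M) :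
    evalForm (insertion L α) ![A, B] x = evalForm α ![L.eval ![A, B]] x := by
  refine (insertAlt_apply (L.toFun x) (α.1 x) _).trans ?_
  have hL : L.eval ![A, B] x = L.toFun x ![A x, B x] := by
    refine congrArg (L.toFun x) ?_
    ext i
    fin_cases i <;> rfl
  simp only [Nat.reduceAdd, Finset.univ_unique, Fin.default_eq_zero, Fin.isValue,
    Fin.val_eq_zero, add_zero, pow_zero, Matrix.cons_val_succ, Matrix.cons_val_fin_one, one_mul,
    Finset.sum_singleton, Finset.Ici_zero_eq_univ, Fin.castSucc_zero, Matrix.cons_val_zero,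
    Fin.removeNth_zero]
  refine congrArg (α.1 x) ?_
  ext i
  rw [Subsingleton.elim i 0]
  exact hL.symm

theorem LieAlgebroid.IsDifferential.unique [VectorBundle ℝ F V] [IsManifold I ∞ M]
    [ContMDiffVectorBundle ∞ F V I] [FiniteDimensional ℝ E] [FiniteDimensional ℝ F]
    [T2Space M] {𝔞 : LieAlgebroid I F V} {D D' : DerivationOne I F V}
    (h : 𝔞.IsDifferential D) (h' : 𝔞.IsDifferential D') : D = D' := by
  refine DerivationOne.ext_of_degree_le_one (fun f => eq_of_evalForm_eq fun A x => ?_)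
    fun α => eq_of_evalForm_eq fun A x => ?_
  · rw [← FinVec.etaExpand_eq A]
    exact (h.function f (A 0) x).trans (h'.function f (A 0) x).symm
  · rw [← FinVec.etaExpand_eq A]
    exact (h.oneForm α (A 0) (A 1) x).trans (h'.oneForm α (A 0) (A 1) x).symm

section Nabla

variable [VectorBundle ℝ F V] [IsManifold I ∞ M]
  [∀ x, IsTopologicalAddGroup (V x)] [∀ x, ContinuousSMul ℝ (V x)]
  [ContMDiffVectorBundle ∞ F V I] [FiniteDimensional ℝ E] [FiniteDimensional ℝ F] [T2Space M]
  (cov : CovariantDerivative I F V) [cov.ContMDiffCovariantDerivative ∞]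

theorem evalForm_nablaForm (q : BundleMapToTangent I F V) {p : ℕ} (η : EForm I F V p)
    (A : Fin (p + 1) → Cₛ^∞⟮I; F, V⟯) (x : M) :
    evalForm (nablaForm cov q η) A x = ∑ i : Fin (p + 1), (-1 : ℝ) ^ (i : ℕ) *
      (anchorDeriv q (A i) (evalForm η (i.removeNth A)) x - ∑ j, evalForm η
        (update (i.removeNth A) j (covAlong cov q (A i) (i.removeNth A j))) x) := by
  refine (AlternatingMap.alternatizeUncurryFin_apply _ _).trans ?_
  refine Finset.sum_congr rfl fun i _ => ?_
  have hcov := covForm_apply_section cov η x (q.toFun x (A i x)) (i.removeNth A)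
  refine (zsmul_eq_mul _ _).trans ?_
  push_cast
  refine congrArg (_ * ·) (hcov.trans ?_)
  refine congrArg (_ - ·) (Finset.sum_congr rfl fun j _ => congrArg (η.1 x) ?_)
  ext k
  obtain rfl | hk := eq_or_ne k j
  · simp [covAlong]
  · simp [hk]

theorem evalForm_nablaForm_zero (q : BundleMapToTangent I F V) (η : EForm I F V 0)
    (A : Cₛ^∞⟮I; F, V⟯) (x : M) :
    evalForm (nablaForm cov q η) ![A] x = anchorDeriv q A (evalForm η ![]) x := by
  have hnil : Fin.removeNth 0 ![A] = ![] := Subsingleton.elim _ _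
  rw [evalForm_nablaForm, Fin.sum_univ_one, Finset.univ_eq_empty, Finset.sum_empty]
  simp [hnil]

theorem evalForm_nablaForm_one (q : BundleMapToTangent I F V) (α : EForm I F V 1)
    (A B : Cₛ^∞⟮I; F, V⟯) (x : M) :
    evalForm (nablaForm cov q α) ![A, B] x =
      (anchorDeriv q A (evalForm α ![B]) x - evalForm α ![covAlong cov q A B] x) -
        (anchorDeriv q B (evalForm α ![A]) x - evalForm α ![covAlong cov q B A] x) := by
  have hleft : Fin.removeNth 0 ![A, B] = ![B] := rfl
  have hright : Fin.removeNth 1 ![A, B] = ![A] := by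
    ext i : 1
    rw [Subsingleton.elim i 0]
    rfl
  have hupdate : ∀ C C' : Cₛ^∞⟮I; F, V⟯, update ![C] 0 C' = ![C'] := fun C C' => by
    ext i : 1
    rw [Subsingleton.elim i 0, update_self]
    rfl
  rw [evalForm_nablaForm, Fin.sum_univ_two, Fin.sum_univ_one, Fin.sum_univ_one]
  simp only [hleft, hright]
  simp [hupdate, sub_eq_add_neg]

theorem isDifferential_nablaDerivation_add_insertionDerivation {𝔞 : LieAlgebroid I F V}
    {L : EValuedForm I F V 2} (hL : ∀ A B, L.eval ![A, B] = (inducedConnection 𝔞 cov).torsion A B) :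
    𝔞.IsDifferential (nablaDerivation cov 𝔞.anchor + insertionDerivation L) where
  function f A x := by
    change evalForm (nablaForm cov 𝔞.anchor (ofFunction f : EForm I F V 0)) ![A] x +
      evalForm (insertion L (ofFunction f)) ![A] x = _
    rw [evalForm_nablaForm_zero, evalForm_insertion_zero, add_zero]
    rfl
  oneForm α A B x := by
    change evalForm (nablaForm cov 𝔞.anchor α) ![A, B] x + evalForm (insertion L α) ![A, B] x = _
    have htorsion : (inducedConnection 𝔞 cov).torsion A B =
        covAlong cov 𝔞.anchor A B - covAlong cov 𝔞.anchor B A - 𝔞.bracket A B := rfl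
    rw [evalForm_nablaForm_one, evalForm_insertion_one, hL, htorsion, evalForm_one_sub,
      evalForm_one_sub]
    ring

end Nabla

end Differential

end LieAlgd

end

theorem mainTheorem11_general
    {E : Type*} [NormedAddCommGroup E] [NormedSpace ℝ E] [FiniteDimensional ℝ E]
    {H : Type*} [TopologicalSpace H] {I : ModelWithCorners ℝ E H}
    {M : Type*} [TopologicalSpace M] [ChartedSpace H M] [IsManifold I ∞ M]
    [T2Space M]
    {F : Type*} [NormedAddCommGroup F] [NormedSpace ℝ F] [FiniteDimensional ℝ F]
    {V : M → Type*} [TopologicalSpace (TotalSpace F V)]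
    [∀ x, AddCommGroup (V x)] [∀ x, Module ℝ (V x)] [∀ x, TopologicalSpace (V x)]
    [∀ x, IsTopologicalAddGroup (V x)] [∀ x, ContinuousSMul ℝ (V x)]
    [FiberBundle F V] [VectorBundle ℝ F V] [ContMDiffVectorBundle ∞ F V I]
    (𝔞 : LieAlgd.LieAlgebroid I F V)
    (cov : CovariantDerivative I F V) [cov.ContMDiffCovariantDerivative ∞] :
    (∃! D : LieAlgd.DerivationOne I F V, 𝔞.IsDifferential D) ∧
    ∃ L : LieAlgd.EValuedForm I F V 2,
      (∀ A B : Cₛ^∞⟮I; F, V⟯,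
        L.eval ![A, B] = (LieAlgd.inducedConnection 𝔞 cov).torsion A B) ∧
      (∀ (A B : Cₛ^∞⟮I; F, V⟯) (x : M),
        L.eval ![A, B] x =
          cov B x (𝔞.anchor.toFun x (A x)) - cov A x (𝔞.anchor.toFun x (B x))
            - 𝔞.bracket A B x) ∧
      ∀ D : LieAlgd.DerivationOne I F V, 𝔞.IsDifferential D →
        ∀ (p : ℕ) (η : LieAlgd.EForm I F V p),
          D.toFun p η = LieAlgd.nablaForm cov 𝔞.anchor η + LieAlgd.insertion L η := by
  obtain ⟨L, hL⟩ := (LieAlgd.inducedConnection 𝔞 cov).exists_torsion_tensor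
  have hD := LieAlgd.isDifferential_nablaDerivation_add_insertionDerivation cov hL
  have hunique : ∀ D, 𝔞.IsDifferential D →
      D = LieAlgd.nablaDerivation cov 𝔞.anchor + LieAlgd.insertionDerivation L :=
    fun D h => h.unique hD
  refine ⟨⟨_, hD, hunique⟩, L, hL, fun A B x => ?_, fun D h p η => ?_⟩
  · rw [hL]
    rfl
  · rw [hunique D h]
    rfl

theorem mainTheorem11
    {E : Type*} [NormedAddCommGroup E] [NormedSpace ℝ E] [FiniteDimensional ℝ E]
    {H : Type*} [TopologicalSpace H] {I : ModelWithCorners ℝ E H}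
    {M : Type*} [TopologicalSpace M] [ChartedSpace H M] [IsManifold I ∞ M]
    [BoundarylessManifold I M] [T2Space M]
    {F : Type*} [NormedAddCommGroup F] [NormedSpace ℝ F] [FiniteDimensional ℝ F]
    {V : M → Type*} [TopologicalSpace (TotalSpace F V)]
    [∀ x, AddCommGroup (V x)] [∀ x, Module ℝ (V x)] [∀ x, TopologicalSpace (V x)]
    [∀ x, IsTopologicalAddGroup (V x)] [∀ x, ContinuousSMul ℝ (V x)]
    [FiberBundle F V] [VectorBundle ℝ F V] [ContMDiffVectorBundle ∞ F V I]
    (𝔞 : LieAlgd.LieAlgebroid I F V)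
    (cov : CovariantDerivative I F V) [cov.ContMDiffCovariantDerivative ∞] :
    (∃! D : LieAlgd.DerivationOne I F V, 𝔞.IsDifferential D) ∧
    ∃ L : LieAlgd.EValuedForm I F V 2,
      (∀ A B : Cₛ^∞⟮I; F, V⟯,
        L.eval ![A, B] = (LieAlgd.inducedConnection 𝔞 cov).torsion A B) ∧
      (∀ (A B : Cₛ^∞⟮I; F, V⟯) (x : M),
        L.eval ![A, B] x =
          cov B x (𝔞.anchor.toFun x (A x)) - cov A x (𝔞.anchor.toFun x (B x))
            - 𝔞.bracket A B x) ∧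
      ∀ D : LieAlgd.DerivationOne I F V, 𝔞.IsDifferential D →
        ∀ (p : ℕ) (η : LieAlgd.EForm I F V p),
          D.toFun p η = LieAlgd.nablaForm cov 𝔞.anchor η + LieAlgd.insertion L η :=
  mainTheorem11_general 𝔞 cov
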